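/- A three-user deterministic interference channel (3-DIC) has finite input alphabets $\mathcal X_1,\mathcal X_2,\mathcal X_3$ and finite output alphabets $\mathcal Y_1,\mathcal Y_2,\mathcal Y_3$. For channel inputs $X_1,X_2,X_3$ its outputs are $$Y_k=f_k(X_{kk},S_k),\qquad X_{lk}=g_{lk}(X_l),\qquad S_1=h_1(X_{21},X_{31}),\quad S_2=h_2(X_{12},X_{32}),\quad S_3=h_3(X_{13},X_{23}),$$ where $g_{lk},h_k,f_k$ ($k,l\in\{1,2,3\}$) are functions between finite alphabets such that each $h_k$ and each $f_k$ is one-to-one when either one of its arguments is fixed. The channel is used $n$ times without memory. Sender $k$ conveys an independent, uniformly distributed message $M_k\in\{1,\dots,2^{\lceil nR_k\rceil}\}$ to receiver $k$. A triple $(R_1,R_2,R_3)$ of nonnegative rates is achievable if there is a sequence of block codes of length $n=0,1,2,\dots$ for which the probability that some receiver does not recover its message tends to $0$ as $n\to\infty$. The capacity region is the closure of the set of achievable rate triples. For $(Q,X_1,X_2,X_3)\sim p(q)p(x_1|q)p(x_2|q)p(x_3|q)$, with $Q$ in a finite alphabet $\mathcal Q$ and entropies in bits, let $\mathscr R_1(Q,X_1,X_2,X_3)$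 be the set of triples of nonnegative rates with \begin{align*} R_1 &< H(X_{11}\,|\,Q),\\ R_1+\min\{R_2,\,H(X_{21}\,|\,Q)\} &< H(Y_1\,|\,X_{31},Q),\\ R_1+\min\{R_3,\,H(X_{31}\,|\,Q)\} &< H(Y_1\,|\,X_{21},Q),\\ R_1+\min\{R_2+R_3,\;R_2+H(X_{31}\,|\,Q),\;H(X_{21}\,|\,Q)+R_3,\;H(S_1\,|\,Q)\} &< H(Y_1\,|\,Q), \end{align*} and let $\mathscr R_2$ and $\mathscr R_3$ be obtained from $\mathscr R_1$ by the subscript replacements $1\mapsto2\mapsto3\mapsto1$ and $1\mapsto3\mapsto2\mapsto1$, respectively. Theorem (interference-decoding inner bound). Every rate triple in $$\mathscr R_{\rm ID}=\bigcup_{(Q,X_1,X_2,X_3)}\ \bigcap_{k=1}^3\mathscr R_k(Q,X_1,X_2,X_3),$$ where the union is over all $(Q,X_1,X_2,X_3)\sim p(q)p(x_1|q)p(x_2|q)p(x_3|q)$ with $|\mathcal Q|\le 13$, is achievable; in particular $\mathscr R_{\rm ID}$ is an inner bound to (a subset of) the capacity region. Moreover, the bound $|\mathcal Q|\le 13$ is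 without loss: the union over all finite alphabets $\mathcal Q$ is the same set. -/

import Mathlib

open Filter Topology

/-- A three-user deterministic interference channel (3-DIC). Users are indexed cyclically by
`Fin 3`, so the two interferers at receiver `k` are `k + 1` and `k + 2`. `X k` and `Y k` are the
input and output alphabets, `L l k` is the alphabet of `X_{lk} = g_{lk}(X_l)`, and `S k` is the
alphabet of the combined interference `S_k = h_k(X_{k+1,k}, X_{k+2,k})` at receiver `k`.
The output is `Y_k = f_k(X_{kk}, S_k)`. The functions `h_k` and `f_k` are one-to-one in each
argument when the other argument is fixed. -/
structure ThreeDIC (X Y S : Fin 3 → Type*) (L : Fin 3 → Fin 3 → Type*) where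
  /-- loss functions `g_{lk}` -/
  g : ∀ l k, X l → L l k
  /-- interference combining functions `h_k` -/
  h : ∀ k, L (k + 1) k → L (k + 2) k → S k
  /-- receiver functions `f_k` -/
  f : ∀ k, L k k → S k → Y k
  h_injective_left : ∀ k b, Function.Injective fun a => h k a b
  h_injective_right : ∀ k a, Function.Injective fun b => h k a b
  f_injective_left : ∀ k s, Function.Injective fun a => f k a s
  f_injective_right : ∀ k a, Function.Injective fun s => f k a s

/-- An input distribution `p(q) p(x₁|q) p(x₂|q) p(x₃|q)` with time-sharing alphabet `Q`. -/
structure InputDist (X : Fin 3 → Type*) [∀ k, Fintype (X k)] (Q : Type*) [Fintype Q] where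
  /-- the pmf `p(q)` -/
  pQ : Q → ℝ
  /-- the conditional pmfs `p(x_k|q)` -/
  pX : ∀ k, Q → X k → ℝ
  pQ_mem : pQ ∈ stdSimplex ℝ Q
  pX_mem : ∀ k q, pX k q ∈ stdSimplex ℝ (X k)

/-- The joint pmf of `(Q, X₁, X₂, X₃)`. -/
def InputDist.joint {X : Fin 3 → Type*} [∀ k, Fintype (X k)] {Q : Type*} [Fintype Q]
    (P : InputDist X Q) (ω : Q × (∀ k, X k)) : ℝ :=
  P.pQ ω.1 * ∏ k, P.pX k ω.1 (ω.2 k)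

open Classical in
/-- The pmf of the random variable `A` when the sample point has pmf `p`. -/
noncomputable def marginal {Ω α : Type*} [Fintype Ω] (p : Ω → ℝ) (A : Ω → α) (a : α) : ℝ :=
  ∑ ω, if A ω = a then p ω else 0

/-- The conditional entropy in bits,
`H(A|B) = -∑_{a,b} p(a,b) log₂ (p(a,b) / p(b))`, with `0 log 0 = 0`. -/
noncomputable def condEntropy {Ω α β : Type*} [Fintype Ω] [Fintype α] [Fintype β]
    (p : Ω → ℝ) (A : Ω → α) (B : Ω → β) : ℝ :=
  -∑ a, ∑ b, marginal p (fun ω => (A ω, B ω)) (a, b) *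
    Real.logb 2 (marginal p (fun ω => (A ω, B ω)) (a, b) / marginal p B b)

namespace ThreeDIC

section Region

variable {X Y S : Fin 3 → Type*} {L : Fin 3 → Fin 3 → Type*}

/-- The combined interference `S_k` as a function of the channel inputs `(x₁, x₂, x₃)`. -/
def interference (ch : ThreeDIC X Y S L) (k : Fin 3) (x : ∀ j, X j) : S k :=
  ch.h k (ch.g (k + 1) k (x (k + 1))) (ch.g (k + 2) k (x (k + 2)))

/-- The channel output `Y_k` as a function of the channel inputs `(x₁, x₂, x₃)`. -/
def output (ch : ThreeDIC X Y S L) (k : Fin 3) (x : ∀ j, X j) : Y k :=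
  ch.f k (ch.g k k (x k)) (ch.interference k x)

variable [∀ k, Fintype (X k)] [∀ k, Fintype (Y k)] [∀ k, Fintype (S k)] [∀ l k, Fintype (L l k)]

/-- `H(X_{lk} | Q)`. -/
noncomputable def entLink (ch : ThreeDIC X Y S L) {Q : Type*} [Fintype Q] (P : InputDist X Q)
    (l k : Fin 3) : ℝ :=
  condEntropy P.joint (fun ω => ch.g l k (ω.2 l)) (fun ω => ω.1)

/-- `H(S_k | Q)`. -/
noncomputable def entInterference (ch : ThreeDIC X Y S L) {Q : Type*} [Fintype Q]
    (P : InputDist X Q) (k : Fin 3) : ℝ :=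
  condEntropy P.joint (fun ω => ch.interference k ω.2) (fun ω => ω.1)

/-- `H(Y_k | Q)`. -/
noncomputable def entOutput (ch : ThreeDIC X Y S L) {Q : Type*} [Fintype Q] (P : InputDist X Q)
    (k : Fin 3) : ℝ :=
  condEntropy P.joint (fun ω => ch.output k ω.2) (fun ω => ω.1)

/-- `H(Y_k | X_{lk}, Q)`. -/
noncomputable def entOutputGivenLink (ch : ThreeDIC X Y S L) {Q : Type*} [Fintype Q]
    (P : InputDist X Q) (l k : Fin 3) : ℝ :=
  condEntropy P.joint (fun ω => ch.output k ω.2) (fun ω => (ch.g l k (ω.2 l), ω.1))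

/-- The region `R_k(Q, X₁, X₂, X₃)` of receiver `k`; the regions for the three receivers arise
from one another by cyclic relabelling of the users. -/
def receiverRegion (ch : ThreeDIC X Y S L) {Q : Type*} [Fintype Q] (P : InputDist X Q)
    (k : Fin 3) : Set (Fin 3 → ℝ) :=
  {R | R k < ch.entLink P k k ∧
    R k + min (R (k + 1)) (ch.entLink P (k + 1) k) < ch.entOutputGivenLink P (k + 2) k ∧
    R k + min (R (k + 2)) (ch.entLink P (k + 2) k) < ch.entOutputGivenLink P (k + 1) k ∧
    R k + min (R (k + 1) + R (k + 2))
        (min (R (k + 1) + ch.entLink P (k + 2) k)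
          (min (ch.entLink P (k + 1) k + R (k + 2)) (ch.entInterference P k)))
      < ch.entOutput P k}

/-- The interference-decoding region: nonnegative rate triples that lie in all three receiver
regions for some input distribution whose time-sharing alphabet has at most 13 elements. -/
def idRegion (ch : ThreeDIC X Y S L) : Set (Fin 3 → ℝ) :=
  {R | (∀ k, 0 ≤ R k) ∧
    ∃ N : ℕ, N ≤ 13 ∧ ∃ P : InputDist X (Fin N), R ∈ ⋂ k, ch.receiverRegion P k}

end Region

end ThreeDIC

/-- A block code of length `n` with message sets `Fin (M k)`. A decoder outputs a message
estimate or an error symbol (`none`). -/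
structure Code (X Y : Fin 3 → Type*) (M : Fin 3 → ℕ) (n : ℕ) where
  enc : ∀ k, Fin (M k) → Fin n → X k
  dec : ∀ k, (Fin n → Y k) → Option (Fin (M k))

namespace ThreeDIC

section Capacity

variable {X Y S : Fin 3 → Type*} {L : Fin 3 → Fin 3 → Type*}

/-- The sequence received at receiver `k` when the message triple is `m`. -/
def received (ch : ThreeDIC X Y S L) {M : Fin 3 → ℕ} {n : ℕ} (c : Code X Y M n)
    (k : Fin 3) (m : ∀ j, Fin (M j)) : Fin n → Y k :=
  fun i => ch.output k fun j => c.enc j (m j) i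

open Classical in
/-- The average probability of error: the probability, for independent and uniformly distributed
messages, that some receiver fails to recover its message. -/
noncomputable def errorProb (ch : ThreeDIC X Y S L) {M : Fin 3 → ℕ} {n : ℕ}
    (c : Code X Y M n) : ℝ :=
  (Finset.univ.filter fun m : ∀ j, Fin (M j) =>
    ∃ k, c.dec k (ch.received c k m) ≠ some (m k)).card / ∏ j, (M j : ℝ)

/-- A nonnegative rate triple is achievable if there is a sequence of
`(2^{nR₁}, 2^{nR₂}, 2^{nR₃}, n)` codes whose error probability tends to `0`, where message set
`k` has `2^⌈n R_k⌉` elements. -/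
def Achievable (ch : ThreeDIC X Y S L) (R : Fin 3 → ℝ) : Prop :=
  (∀ k, 0 ≤ R k) ∧
    ∃ c : ∀ n : ℕ, Code X Y (fun k => 2 ^ ⌈(n : ℝ) * R k⌉₊) n,
      Tendsto (fun n => ch.errorProb (c n)) atTop (𝓝 0)

/-- The capacity region: the closure of the set of achievable rate triples. -/
def capacityRegion (ch : ThreeDIC X Y S L) : Set (Fin 3 → ℝ) :=
  closure {R | ch.Achievable R}

end Capacity

end ThreeDIC

/-!
Achievability is by random coding with a fresh time-sharing symbol and independent inputs in every
position. Receiver `k` takes the message of user `k` from any message triple that explains its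
output exactly (the channel is deterministic) and for which the three interfering signals
`X_{k+1,k}`, `X_{k+2,k}`, `S_k` are typical; this need not identify the interferers' messages.
Wrong messages are split by which of the interferers' messages are wrong as well.
In each case the competitors can be counted in several ways, which is where the minima come from:
by the messages of an interferer, or by the typical values of an interfering signal.

No counting of typical sequences is needed. A value is typical if its probability is at least
`1 / a` for a threshold `a` such as `2 ^ (n (H + ε))`. Hence the indicator of a typical value is at
most `a` times its probability, so that a union over typical values costs a factor `a` and turns the value
into a freshly drawn one (`sum_typical_le`). What remains is the probability that fresh inputs
produce the received output, perhaps given one interfering signal, and this is at most the threshold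
`2 ^ (-n (H - ε))` if the received signal is typical. The resulting one-shot bound
`ThreeDIC.exists_code_le` holds for any channel; it is applied to the `n`-fold product channel
`ThreeDIC.pow`. Since laws of blocks are products over the positions (`law_pi`), typicality of
the transmitted block follows from a Chernoff bound (`tendsto_blockProb_sum_nonneg`), once
the conditional entropies are written as means of `-log₂` of these laws (`selfEntropy`).

For the size of the time-sharing alphabet, the twelve inequalities of the three receivers are
considered for a given `R` and a given input distribution. Replacing each minimum by a term that
attains it leaves twelve inequalities between means over the time-sharing symbol, each of them
sufficient for the original one under any other law of that symbol. By Carathéodory's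
theorem in dimension twelve, thirteen values of the symbol realize the same means.
-/

/-! ### Expectations of independent coordinates -/

open Classical in
/-- The indicator of a proposition as a real number. -/
noncomputable def ind (P : Prop) : ℝ := if P then 1 else 0

lemma ind_of_true {P : Prop} (h : P) : ind P = 1 := if_pos h

lemma ind_of_false {P : Prop} (h : ¬P) : ind P = 0 := if_neg h

lemma ind_nonneg (P : Prop) : 0 ≤ ind P := by unfold ind; split_ifs <;> norm_num

lemma ind_le_one (P : Prop) : ind P ≤ 1 := by unfold ind; split_ifs <;> norm_num

lemma ind_mono {P Q : Prop} (h : P → Q) : ind P ≤ ind Q := by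
  by_cases hP : P
  · rw [ind_of_true hP, ind_of_true (h hP)]
  · rw [ind_of_false hP]; exact ind_nonneg Q

lemma ind_or_le (P Q : Prop) : ind (P ∨ Q) ≤ ind P + ind Q := by
  by_cases hP : P <;> by_cases hQ : Q <;> simp [ind, hP, hQ]

section ProductExpectation

lemma prod_update_mul {ι : Type*} {A : ι → Type*} [Fintype ι] [DecidableEq ι]
    (p : ∀ i, A i → ℝ) (z : ∀ i, A i) (l : ι) (a : A l) :
    (∏ i, p i (Function.update z l a i)) * p l (z l) = (∏ i, p i (z i)) * p l a := by
  rw [← Finset.mul_prod_erase _ _ (Finset.mem_univ l),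
    ← Finset.mul_prod_erase _ (fun i => p i (z i)) (Finset.mem_univ l), Function.update_self]
  have : ∏ i ∈ Finset.univ.erase l, p i (Function.update z l a i) =
      ∏ i ∈ Finset.univ.erase l, p i (z i) :=
    Finset.prod_congr rfl fun i hi => by rw [Function.update_of_ne (Finset.ne_of_mem_erase hi)]
  rw [this]
  ring

variable {ι : Type*} {A : ι → Type*} [Fintype ι] [DecidableEq ι] [∀ i, Fintype (A i)]

/-- The expectation of `φ` when the coordinates are independent and coordinate `i` has
pmf `p i`. -/
noncomputable def prodExp (p : ∀ i, A i → ℝ) (φ : (∀ i, A i) → ℝ) : ℝ :=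
  ∑ x, (∏ i, p i (x i)) * φ x

lemma prod_mem_stdSimplex {p : ∀ i, A i → ℝ} (hp : ∀ i, p i ∈ stdSimplex ℝ (A i)) :
    (fun x : ∀ i, A i => ∏ i, p i (x i)) ∈ stdSimplex ℝ (∀ i, A i) := by
  refine ⟨fun x => Finset.prod_nonneg fun i _ => (hp i).1 _, ?_⟩
  rw [← Fintype.prod_sum]
  exact Finset.prod_eq_one fun i _ => (hp i).2

lemma prodExp_mono {p : ∀ i, A i → ℝ} (hp : ∀ i, p i ∈ stdSimplex ℝ (A i))
    {φ ψ : (∀ i, A i) → ℝ} (h : ∀ x, φ x ≤ ψ x) : prodExp p φ ≤ prodExp p ψ :=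
  Finset.sum_le_sum fun x _ => mul_le_mul_of_nonneg_left (h x) ((prod_mem_stdSimplex hp).1 x)

lemma prodExp_nonneg {p : ∀ i, A i → ℝ} (hp : ∀ i, p i ∈ stdSimplex ℝ (A i))
    {φ : (∀ i, A i) → ℝ} (h : ∀ x, 0 ≤ φ x) : 0 ≤ prodExp p φ :=
  Finset.sum_nonneg fun x _ => mul_nonneg ((prod_mem_stdSimplex hp).1 x) (h x)

lemma prodExp_const {p : ∀ i, A i → ℝ} (hp : ∀ i, p i ∈ stdSimplex ℝ (A i)) (c : ℝ) :
    prodExp p (fun _ => c) = c := by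
  rw [prodExp, ← Finset.sum_mul, (prod_mem_stdSimplex hp).2, one_mul]

lemma prodExp_const_mul (p : ∀ i, A i → ℝ) (c : ℝ) (φ : (∀ i, A i) → ℝ) :
    prodExp p (fun x => c * φ x) = c * prodExp p φ := by
  simp only [prodExp, Finset.mul_sum]
  exact Finset.sum_congr rfl fun x _ => by ring

lemma prodExp_mul_const (p : ∀ i, A i → ℝ) (c : ℝ) (φ : (∀ i, A i) → ℝ) :
    prodExp p (fun x => φ x * c) = prodExp p φ * c := by
  simp only [mul_comm _ c, prodExp_const_mul]

lemma prodExp_add (p : ∀ i, A i → ℝ) (φ ψ : (∀ i, A i) → ℝ) :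
    prodExp p (fun x => φ x + ψ x) = prodExp p φ + prodExp p ψ := by
  simp only [prodExp, mul_add, Finset.sum_add_distrib]

lemma prodExp_sum (p : ∀ i, A i → ℝ) {J : Type*} (s : Finset J) (φ : J → (∀ i, A i) → ℝ) :
    prodExp p (fun x => ∑ j ∈ s, φ j x) = ∑ j ∈ s, prodExp p (φ j) := by
  simp only [prodExp, Finset.mul_sum]
  exact Finset.sum_comm

lemma prodExp_comm {κ : Type*} {B : κ → Type*} [Fintype κ] [DecidableEq κ] [∀ i, Fintype (B i)]
    (p : ∀ i, A i → ℝ) (r : ∀ i, B i → ℝ) (φ : (∀ i, A i) → (∀ i, B i) → ℝ) :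
    prodExp p (fun x => prodExp r fun y => φ x y) =
      prodExp r (fun y => prodExp p fun x => φ x y) := by
  simp only [prodExp, Finset.mul_sum]
  rw [Finset.sum_comm]
  exact Finset.sum_congr rfl fun y _ => Finset.sum_congr rfl fun x _ => by ring

/-- Redrawing one coordinate from its own law does not change an expectation. -/
lemma prodExp_update {p : ∀ i, A i → ℝ} (hp : ∀ i, p i ∈ stdSimplex ℝ (A i)) (l : ι)
    (φ : (∀ i, A i) → ℝ) :
    prodExp p (fun z => prodExp p fun z' => φ (Function.update z l (z' l))) = prodExp p φ := by
  -- Exchanging the `l`-th coordinates of `z` and `z'` preserves the joint weight.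
  let e : (∀ i, A i) × (∀ i, A i) ≃ (∀ i, A i) × (∀ i, A i) :=
    { toFun := fun u => (Function.update u.1 l (u.2 l), Function.update u.2 l (u.1 l))
      invFun := fun u => (Function.update u.1 l (u.2 l), Function.update u.2 l (u.1 l))
      left_inv := fun u => by simp
      right_inv := fun u => by simp }
  have key : ∀ u : (∀ i, A i) × (∀ i, A i),
      (∏ i, p i ((e u).1 i)) * (∏ i, p i ((e u).2 i)) =
        (∏ i, p i (u.1 i)) * (∏ i, p i (u.2 i)) := fun u => by
    have hu (i : ι) : p i ((e u).1 i) * p i ((e u).2 i) = p i (u.1 i) * p i (u.2 i) := by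
      by_cases h : i = l
      · subst h; simp [e, mul_comm]
      · simp [e, Function.update_of_ne h]
    rw [← Finset.prod_mul_distrib, ← Finset.prod_mul_distrib]
    exact Finset.prod_congr rfl fun i _ => hu i
  calc _ = ∑ u : (∀ i, A i) × (∀ i, A i),
        (∏ i, p i (u.1 i)) * (∏ i, p i (u.2 i)) * φ ((e u).1) := by
        simp only [prodExp, Finset.mul_sum, Fintype.sum_prod_type, ← mul_assoc]
        rfl
    _ = ∑ u : (∀ i, A i) × (∀ i, A i), (∏ i, p i (u.1 i)) * (∏ i, p i (u.2 i)) * φ u.1 := by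
        rw [← Equiv.sum_comp e fun u : (∀ i, A i) × (∀ i, A i) =>
          (∏ i, p i (u.1 i)) * (∏ i, p i (u.2 i)) * φ u.1]
        simp only [key]
    _ = prodExp p (fun z => prodExp p fun _ => φ z) := by
        simp only [prodExp, Finset.mul_sum, Fintype.sum_prod_type, ← mul_assoc]
    _ = _ := by simp only [prodExp_const hp]

/-- A function that ignores coordinate `l` is independent of a function of coordinate `l`. -/
lemma prodExp_mul_of_indep {p : ∀ i, A i → ℝ} (hp : ∀ i, p i ∈ stdSimplex ℝ (A i)) (l : ι)
    {φ : (∀ i, A i) → ℝ} {ψ : A l → ℝ} (hφ : ∀ z a, φ (Function.update z l a) = φ z) :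
    prodExp p (fun z => φ z * ψ (z l)) = prodExp p φ * prodExp p fun z => ψ (z l) := by
  rw [← prodExp_update hp l]
  simp only [hφ, Function.update_self, prodExp_const_mul, prodExp_mul_const]

/-- Expectations of products over independent positions factor. -/
lemma prodExp_pi_prod {κ : Type*} [Fintype κ] [DecidableEq κ] (p : κ → ∀ i, A i → ℝ)
    (ψ : κ → (∀ i, A i) → ℝ) :
    prodExp (fun i (a : κ → A i) => ∏ t, p t i (a t)) (fun x => ∏ t, ψ t fun i => x i t) =
      ∏ t, prodExp (p t) (ψ t) := by
  simp only [prodExp, Fintype.prod_sum]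
  rw [← Equiv.sum_comp (Equiv.piComm fun (_ : κ) (i : ι) => A i)]
  refine Finset.sum_congr rfl fun x _ => ?_
  rw [Finset.prod_mul_distrib, Finset.prod_comm]
  rfl

/-- Redrawing the codewords of one message tuple `m` does not change the expectation over
a random codebook with independent codewords. -/
lemma prodExp_codebook_update {B : ι → Type*} [∀ i, Fintype (B i)] [∀ i, DecidableEq (B i)]
    {p : ∀ i, A i → ℝ} (hp : ∀ i, p i ∈ stdSimplex ℝ (A i)) (m : ∀ i, B i)
    (φ : (∀ i, B i → A i) → ℝ) :
    prodExp (fun i (c : B i → A i) => ∏ b, p i (c b)) (fun c => prodExp p fun x =>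
      φ fun i => Function.update (c i) (m i) (x i)) =
    prodExp (fun i (c : B i → A i) => ∏ b, p i (c b)) φ := by
  -- Exchanging `x` with the codewords of `m` preserves the joint weight.
  let e : (∀ i, B i → A i) × (∀ i, A i) ≃ (∀ i, B i → A i) × (∀ i, A i) :=
    { toFun := fun u => (fun i => Function.update (u.1 i) (m i) (u.2 i), fun i => u.1 i (m i))
      invFun := fun u => (fun i => Function.update (u.1 i) (m i) (u.2 i), fun i => u.1 i (m i))
      left_inv := fun u => by simp
      right_inv := fun u => by simp }
  have key : ∀ u : (∀ i, B i → A i) × (∀ i, A i),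
      (∏ i, ∏ b, p i ((e u).1 i b)) * (∏ i, p i ((e u).2 i)) =
        (∏ i, ∏ b, p i (u.1 i b)) * (∏ i, p i (u.2 i)) := fun u => by
    rw [← Finset.prod_mul_distrib, ← Finset.prod_mul_distrib]
    exact Finset.prod_congr rfl fun i _ =>
      prod_update_mul (fun _ => p i) (u.1 i) (m i) (u.2 i)
  calc _ = ∑ u : (∀ i, B i → A i) × (∀ i, A i),
        (∏ i, ∏ b, p i (u.1 i b)) * (∏ i, p i (u.2 i)) * φ ((e u).1) := by
        simp only [prodExp, Finset.mul_sum, Fintype.sum_prod_type, ← mul_assoc]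
        rfl
    _ = ∑ u : (∀ i, B i → A i) × (∀ i, A i),
        (∏ i, ∏ b, p i (u.1 i b)) * (∏ i, p i (u.2 i)) * φ u.1 := by
        rw [← Equiv.sum_comp e fun u : (∀ i, B i → A i) × (∀ i, A i) =>
          (∏ i, ∏ b, p i (u.1 i b)) * (∏ i, p i (u.2 i)) * φ u.1]
        simp only [key]
    _ = prodExp (fun i (c : B i → A i) => ∏ b, p i (c b)) (fun c => prodExp p fun _ => φ c) := by
        simp only [prodExp, Finset.mul_sum, Fintype.sum_prod_type, ← mul_assoc]
    _ = _ := by simp only [prodExp_const hp]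

/-- The law of `F` under independent coordinates: the probability of `F = a`. -/
noncomputable def law {α : Type*} (p : ∀ i, A i → ℝ) (F : (∀ i, A i) → α) (a : α) : ℝ :=
  prodExp p fun x => ind (F x = a)

lemma law_nonneg {α : Type*} {p : ∀ i, A i → ℝ} (hp : ∀ i, p i ∈ stdSimplex ℝ (A i))
    (F : (∀ i, A i) → α) (a : α) : 0 ≤ law p F a :=
  prodExp_nonneg hp fun _ => ind_nonneg _

lemma law_self_pos {α : Type*} {p : ∀ i, A i → ℝ} (hp : ∀ i, p i ∈ stdSimplex ℝ (A i))
    (F : (∀ i, A i) → α) {x : ∀ i, A i} (hx : ∏ i, p i (x i) ≠ 0) : 0 < law p F (F x) := by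
  classical
  have hx' : 0 < ∏ i, p i (x i) := lt_of_le_of_ne ((prod_mem_stdSimplex hp).1 x) hx.symm
  refine hx'.trans_le ?_
  have := Finset.single_le_sum
    (f := fun z => (∏ i, p i (z i)) * ind (F z = F x))
    (fun z _ => mul_nonneg ((prod_mem_stdSimplex hp).1 z) (ind_nonneg _))
    (Finset.mem_univ x)
  simpa [law, prodExp, ind] using this

/-- Expectations of functions of `V` through the law of `V`. -/
lemma sum_law_mul {β : Type*} [Fintype β] (p : ∀ i, A i → ℝ) (V : (∀ i, A i) → β) (ψ : β → ℝ) :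
    ∑ b, law p V b * ψ b = prodExp p fun x => ψ (V x) := by
  classical
  simp only [law, ← prodExp_mul_const, ← prodExp_sum]
  congr 1
  funext x
  simp [ind]

/-- Laws of blocks of independent positions factor. -/
lemma law_pi {κ : Type*} [Fintype κ] [DecidableEq κ] {α : Type*} (p : κ → ∀ i, A i → ℝ)
    (F : κ → (∀ i, A i) → α) (a : κ → α) :
    law (fun i (a : κ → A i) => ∏ t, p t i (a t)) (fun x t => F t fun i => x i t) a =
      ∏ t, law (p t) (F t) (a t) := by
  classical
  simp only [law, ← prodExp_pi_prod]
  congr 1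
  funext x
  simp only [ind]
  rw [Finset.prod_ite_zero]
  simp [funext_iff]

end ProductExpectation

/-! ### Random codebooks -/

section RandomCodebook

variable {X : Fin 3 → Type*} [∀ k, Fintype (X k)] {M : Fin 3 → ℕ}

/-- The triple of codewords that the codebook `c` assigns to the message triple `m`. -/
def codewords (c : ∀ k, Fin (M k) → X k) (m : ∀ k, Fin (M k)) (k : Fin 3) : X k := c k (m k)

/-- The expectation over a random codebook whose codewords are independent, those of user `k`
having pmf `p k`. -/
noncomputable def codebookExp (p : ∀ k, X k → ℝ) (φ : (∀ k, Fin (M k) → X k) → ℝ) : ℝ :=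
  prodExp (fun k (c : Fin (M k) → X k) => ∏ m, p k (c m)) φ

/-- The probability of the event `E` for a random codebook. -/
noncomputable def codebookProb (p : ∀ k, X k → ℝ) (E : (∀ k, Fin (M k) → X k) → Prop) : ℝ :=
  codebookExp p fun c => ind (E c)

lemma codebook_weight_mem_stdSimplex {p : ∀ k, X k → ℝ} (hp : ∀ k, p k ∈ stdSimplex ℝ (X k))
    (k : Fin 3) :
    (fun c : Fin (M k) → X k => ∏ m, p k (c m)) ∈ stdSimplex ℝ (Fin (M k) → X k) :=
  prod_mem_stdSimplex fun _ => hp k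

lemma codebookExp_mono {p : ∀ k, X k → ℝ} (hp : ∀ k, p k ∈ stdSimplex ℝ (X k))
    {φ ψ : (∀ k, Fin (M k) → X k) → ℝ} (h : ∀ c, φ c ≤ ψ c) :
    codebookExp p φ ≤ codebookExp p ψ :=
  prodExp_mono (codebook_weight_mem_stdSimplex hp) h

/-- The joint law of the codewords of the message triples `m` and `m'`: a user whose message
is the same in both has the same codeword in both, the other codewords are independent. -/
lemma codebookExp_pair {p : ∀ k, X k → ℝ} (hp : ∀ k, p k ∈ stdSimplex ℝ (X k))
    (m m' : ∀ k, Fin (M k)) (φ : (∀ k, X k) → (∀ k, X k) → ℝ) :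
    codebookExp p (fun c => φ (codewords c m) (codewords c m')) =
      prodExp p fun x => prodExp p fun z => φ x fun i => if m' i = m i then x i else z i := by
  have hm (c : ∀ k, Fin (M k) → X k) (x : ∀ k, X k) :
      codewords (X := X) (fun i => Function.update (c i) (m i) (x i)) m = x := by
    funext i; simp [codewords]
  have hm' (c : ∀ k, Fin (M k) → X k) (x z : ∀ k, X k) :
      codewords (X := X)
          (fun i => Function.update (Function.update (c i) (m' i) (z i)) (m i) (x i)) m' =
        fun i => if m' i = m i then x i else z i := by
    funext i; by_cases h : m' i = m i <;> simp [codewords, h]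
  rw [codebookExp, ← prodExp_codebook_update hp m, ← prodExp_codebook_update hp m']
  simp only [hm, hm', prodExp_const (codebook_weight_mem_stdSimplex hp)]
  rw [prodExp_comm]

lemma codebookProb_mono {p : ∀ k, X k → ℝ} (hp : ∀ k, p k ∈ stdSimplex ℝ (X k))
    {E F : (∀ k, Fin (M k) → X k) → Prop} (h : ∀ c, E c → F c) :
    codebookProb p E ≤ codebookProb p F :=
  codebookExp_mono hp fun c => ind_mono (h c)

lemma codebookProb_or_le {p : ∀ k, X k → ℝ} (hp : ∀ k, p k ∈ stdSimplex ℝ (X k))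
    (E F : (∀ k, Fin (M k) → X k) → Prop) :
    codebookProb p (fun c => E c ∨ F c) ≤ codebookProb p E + codebookProb p F := by
  rw [codebookProb, codebookProb, codebookProb, codebookExp, codebookExp, codebookExp,
    ← prodExp_add]
  exact codebookExp_mono hp fun c => ind_or_le _ _

lemma codebookExp_single {p : ∀ k, X k → ℝ} (hp : ∀ k, p k ∈ stdSimplex ℝ (X k))
    (m : ∀ k, Fin (M k)) (φ : (∀ k, X k) → ℝ) :
    codebookExp p (fun c => φ (codewords c m)) = prodExp p φ := by
  rw [codebookExp_pair hp m m fun x _ => φ x]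
  simp only [prodExp_const hp]

/-- The union bound over competing message triples `μ j`, conditionally on the transmitted
codewords. The predicate `V` restricts the index `j`, as a rule to messages that differ from those
of `m`, so that their codewords are freshly drawn; `G` is a weight that is at least one when
`μ j` is confused with `m`. -/
lemma codebookProb_and_le {p : ∀ k, X k → ℝ} (hp : ∀ k, p k ∈ stdSimplex ℝ (X k))
    {m : ∀ k, Fin (M k)} {J : Type*} [Fintype J] (μ : J → ∀ k, Fin (M k)) (V : J → Prop)
    {T : (∀ k, X k) → Prop} {E : (∀ k, Fin (M k) → X k) → Prop}
    (G : (∀ k, X k) → (∀ k, X k) → ℝ) (hG : ∀ x z, 0 ≤ G x z)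
    (hE : ∀ c, T (codewords c m) → E c →
      ∃ j, V j ∧ 1 ≤ G (codewords c m) (codewords c (μ j)))
    {B : ℝ} (hB : 0 ≤ B)
    (hGB : ∀ j, V j → ∀ x, T x →
      prodExp p (fun z => G x fun i => if μ j i = m i then x i else z i) ≤ B) :
    codebookProb p (fun c => T (codewords c m) ∧ E c) ≤
      Fintype.card J * B := by
  classical
  let Φ : J → (∀ k, X k) → (∀ k, X k) → ℝ := fun j x z => if V j ∧ T x then G x z else 0
  have hΦ (j : J) (x z : ∀ k, X k) : 0 ≤ Φ j x z := by
    simp only [Φ]; split_ifs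
    exacts [hG x z, le_rfl]
  calc _ ≤ codebookExp p fun c => ∑ j, Φ j (codewords c m) (codewords c (μ j)) := by
        refine codebookExp_mono hp fun c => ?_
        by_cases h : T (codewords c m) ∧ E c
        · rw [ind_of_true h]
          obtain ⟨j, hj, hj1⟩ := hE c h.1 h.2
          refine le_trans ?_ (Finset.single_le_sum (fun j _ => hΦ j _ _) (Finset.mem_univ j))
          simpa [Φ, hj, h.1] using hj1
        · rw [ind_of_false h]
          exact Finset.sum_nonneg fun j _ => hΦ j _ _
    _ = ∑ j, prodExp p fun x => prodExp p fun z =>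
          Φ j x fun i => if μ j i = m i then x i else z i := by
        rw [codebookExp, prodExp_sum]
        exact Finset.sum_congr rfl fun j _ => codebookExp_pair hp m (μ j) (Φ j)
    _ ≤ ∑ _j : J, B := by
        refine Finset.sum_le_sum fun j _ => ?_
        rw [← prodExp_const hp B]
        refine prodExp_mono hp fun x => ?_
        by_cases h : V j ∧ T x
        · simpa only [Φ, h, and_self, if_true, prodExp_const hp] using hGB j h.1 x h.2
        · simp only [Φ, h, if_false, prodExp_const hp]
          exact hB
    _ = _ := by simp

/-- A sum over the values `b` of `V` of probability at least `1 / a` is at most `a` times the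
expectation. This replaces a count of the typical values. -/
lemma sum_typical_le {p : ∀ k, X k → ℝ} (hp : ∀ k, p k ∈ stdSimplex ℝ (X k)) {β : Type*}
    [Fintype β] (V : (∀ k, X k) → β) {ψ : β → ℝ} (hψ : ∀ b, 0 ≤ ψ b) {a : ℝ} (ha : 0 ≤ a) :
    ∑ b, ind (1 ≤ a * law p V b) * ψ b ≤ a * prodExp p fun x => ψ (V x) := by
  rw [← sum_law_mul, Finset.mul_sum]
  refine Finset.sum_le_sum fun b _ => ?_
  by_cases h : 1 ≤ a * law p V b
  · rw [ind_of_true h]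
    nlinarith [hψ b]
  · rw [ind_of_false h, zero_mul]
    exact mul_nonneg ha (mul_nonneg (law_nonneg hp V b) (hψ b))

end RandomCodebook

lemma fin_three_add_one_ne (k : Fin 3) : k + 1 ≠ k := by revert k; decide
lemma fin_three_add_two_ne (k : Fin 3) : k + 2 ≠ k := by revert k; decide
lemma fin_three_add_two_ne_add_one (k : Fin 3) : k + 2 ≠ k + 1 := by revert k; decide
lemma fin_three_cases (k i : Fin 3) : i = k ∨ i = k + 1 ∨ i = k + 2 := by revert k i; decide

lemma fin_three_prod (k : Fin 3) (a : Fin 3 → ℝ) : ∏ i, a i = a k * (a (k + 1) * a (k + 2)) := by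
  have h : (Finset.univ : Finset (Fin 3)) = {k, k + 1, k + 2} := by revert k; decide
  rw [h, Finset.prod_insert, Finset.prod_insert, Finset.prod_singleton]
  · simp
  · simp

section Competitors

variable {A : Fin 3 → Type*} {M : Fin 3 → ℕ}

lemma ite_update_one (k : Fin 3) (m : ∀ i, Fin (M i)) {a : Fin (M k)} (ha : a ≠ m k)
    (x z : ∀ i, A i) :
    (fun i => if Function.update m k a i = m i then x i else z i) =
      Function.update x k (z k) := by
  funext i
  by_cases h : i = k
  · subst h; simp [ha]
  · simp [h]

lemma ite_update_two {k l r : Fin 3} (hlk : l ≠ k) (hrk : r ≠ k) (hrl : r ≠ l)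
    (hc : ∀ i, i = k ∨ i = l ∨ i = r) (m : ∀ i, Fin (M i)) {a : Fin (M k)} (ha : a ≠ m k)
    {b : Fin (M l)} (hb : b ≠ m l) (x z : ∀ i, A i) :
    (fun i => if Function.update (Function.update m k a) l b i = m i then x i else z i) =
      Function.update z r (x r) := by
  funext i
  rcases hc i with h | h | h
  · subst h; simp [Function.update_of_ne hlk.symm, Function.update_of_ne hrk.symm, ha]
  · subst h; simp [Function.update_of_ne hrl.symm, hb]
  · subst h; simp [Function.update_of_ne hrl, Function.update_of_ne hrk]

lemma update_two_eq {k l r : Fin 3} (hlk : l ≠ k) (hc : ∀ i, i = k ∨ i = l ∨ i = r)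
    {m m' : ∀ i, A i} (hr : m' r = m r) :
    Function.update (Function.update m k (m' k)) l (m' l) = m' := by
  funext i
  rcases hc i with h | h | h
  · subst h; simp [Function.update_of_ne hlk.symm]
  · subst h; simp
  · subst h
    by_cases h1 : i = l
    · subst h1; simp
    · by_cases h2 : i = k
      · subst h2; simp [Function.update_of_ne h1]
      · simp [Function.update_of_ne h1, Function.update_of_ne h2, hr]

end Competitors

namespace ThreeDIC

section Output

variable {X Y S : Fin 3 → Type*} {L : Fin 3 → Fin 3 → Type*} (ch : ThreeDIC X Y S L) (k : Fin 3)

lemma output_eq (x : ∀ j, X j) : ch.output k x = ch.f k (ch.g k k (x k))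
    (ch.h k (ch.g (k + 1) k (x (k + 1))) (ch.g (k + 2) k (x (k + 2)))) := rfl

lemma output_update_self (x : ∀ j, X j) (a : X k) :
    ch.output k (Function.update x k a) = ch.f k (ch.g k k a) (ch.interference k x) := by
  simp [output, interference]

lemma output_update_fst (x : ∀ j, X j) (a : X (k + 1)) :
    ch.output k (Function.update x (k + 1) a) = ch.f k (ch.g k k (x k))
      (ch.h k (ch.g (k + 1) k a) (ch.g (k + 2) k (x (k + 2)))) := by
  simp [output, interference]

lemma output_update_snd (x : ∀ j, X j) (a : X (k + 2)) :
    ch.output k (Function.update x (k + 2) a) = ch.f k (ch.g k k (x k))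
      (ch.h k (ch.g (k + 1) k (x (k + 1))) (ch.g (k + 2) k a)) := by
  simp [output, interference]

/-- The output at receiver `k` depends on the input of user `l` only through `X_{lk}`. -/
lemma output_congr {x x' : ∀ j, X j} (h : ∀ l, ch.g l k (x l) = ch.g l k (x' l)) :
    ch.output k x = ch.output k x' := by
  simp only [output, interference, h]

end Output

end ThreeDIC

/-! ### Competing messages at one receiver -/

/-- The thresholds of one receiver. The first three bound the number of typical values of the
interfering signals `X_{k+1,k}`, `X_{k+2,k}`, `S_k`, the other four bound the probabilities of
the typical values of `X_{kk}`, of `Y_k` given `X_{k+2,k}`, of `Y_k` given `X_{k+1,k}`, and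
of `Y_k`. -/
structure Thresholds where
  fst : ℝ
  snd : ℝ
  sum : ℝ
  desired : ℝ
  outGivenSnd : ℝ
  outGivenFst : ℝ
  out : ℝ
  fst_nonneg : 0 ≤ fst
  snd_nonneg : 0 ≤ snd
  sum_nonneg : 0 ≤ sum
  desired_nonneg : 0 ≤ desired
  outGivenSnd_nonneg : 0 ≤ outGivenSnd
  outGivenFst_nonneg : 0 ≤ outGivenFst
  out_nonneg : 0 ≤ out

namespace ThreeDIC

section Receiver

variable {X Y S : Fin 3 → Type*} {L : Fin 3 → Fin 3 → Type*} [∀ k, Fintype (X k)]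

/-- The interference at receiver `k` is typical: none of the three interfering signals has
a value of too small a probability. Laws are under independent inputs with pmfs `p`. -/
def InterferenceTypical (ch : ThreeDIC X Y S L) (p : ∀ k, X k → ℝ) (k : Fin 3) (θ : Thresholds)
    (x : ∀ k, X k) : Prop :=
  1 ≤ θ.fst * law p (fun z => ch.g (k + 1) k (z (k + 1))) (ch.g (k + 1) k (x (k + 1))) ∧
  1 ≤ θ.snd * law p (fun z => ch.g (k + 2) k (z (k + 2))) (ch.g (k + 2) k (x (k + 2))) ∧
  1 ≤ θ.sum * law p (ch.interference k) (ch.interference k x)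

/-- The received signal is typical: neither `X_{kk}` nor `Y_k`, alone or given one of the
interfering signals, has a value of too large a probability. Updating coordinate `l` of a fresh
input `z` to `x l` expresses conditioning on `X_{lk}`. -/
def OutputTypical (ch : ThreeDIC X Y S L) (p : ∀ k, X k → ℝ) (k : Fin 3) (θ : Thresholds)
    (x : ∀ k, X k) : Prop :=
  law p (fun z => ch.g k k (z k)) (ch.g k k (x k)) ≤ θ.desired ∧
  law p (fun z => ch.output k (Function.update z (k + 2) (x (k + 2)))) (ch.output k x)
    ≤ θ.outGivenSnd ∧
  law p (fun z => ch.output k (Function.update z (k + 1) (x (k + 1)))) (ch.output k x)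
    ≤ θ.outGivenFst ∧
  law p (ch.output k) (ch.output k x) ≤ θ.out

variable {M : Fin 3 → ℕ}

/-- With codebook `c` and transmitted messages `m`, the triple `m'` competes with `m` at receiver
`k`: it has another message of user `k`, typical interference, and the same output. -/
def Competes (ch : ThreeDIC X Y S L) (p : ∀ k, X k → ℝ) (k : Fin 3) (θ : Thresholds)
    (c : ∀ k, Fin (M k) → X k) (m m' : ∀ k, Fin (M k)) : Prop :=
  m' k ≠ m k ∧ ch.output k (codewords c m') = ch.output k (codewords c m) ∧
    ch.InterferenceTypical p k θ (codewords c m')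

variable (ch : ThreeDIC X Y S L) {p : ∀ k, X k → ℝ} (hp : ∀ k, p k ∈ stdSimplex ℝ (X k))
  (k : Fin 3) (θ : Thresholds) (m : ∀ k, Fin (M k))

include hp

/-- Only the desired message is wrong: the competitor must have the transmitted value of
`X_{kk}`. -/
lemma desired_wrong_le :
    codebookProb p (fun c => ch.OutputTypical p k θ (codewords c m) ∧
      ∃ m', ch.Competes p k θ c m m' ∧ m' (k + 1) = m (k + 1) ∧ m' (k + 2) = m (k + 2))
      ≤ M k * θ.desired := by
  refine (codebookProb_and_le hp (T := ch.OutputTypical p k θ)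
    (fun a : Fin (M k) => Function.update m k a) (fun a => a ≠ m k)
    (fun x z => ind (ch.output k z = ch.output k x)) (fun _ _ => ind_nonneg _) ?_
    θ.desired_nonneg ?_).trans_eq (by simp)
  · rintro c - ⟨m', hm', h1, h2⟩
    have hm : Function.update m k (m' k) = m' := by
      funext i
      rcases fin_three_cases k i with h | h | h
      · subst h; simp
      · subst h; simp [h1]
      · subst h; simp [h2]
    refine ⟨m' k, hm'.1, ?_⟩
    simp only [hm]
    rw [ind_of_true hm'.2.1]
  · intro a ha x hx
    refine le_trans (prodExp_mono hp fun z => ?_) hx.1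
    rw [ite_update_one k m ha, output_update_self]
    -- With the interference fixed, the output determines `X_{kk}`.
    exact ind_mono fun h => ch.f_injective_left k _ h

/-- The messages of users `k` and `k + 1` are wrong, counted by messages. -/
lemma fst_wrong_le :
    codebookProb p (fun c => ch.OutputTypical p k θ (codewords c m) ∧
      ∃ m', ch.Competes p k θ c m m' ∧ m' (k + 1) ≠ m (k + 1) ∧ m' (k + 2) = m (k + 2))
      ≤ M k * M (k + 1) * θ.outGivenSnd := by
  refine (codebookProb_and_le hp (T := ch.OutputTypical p k θ)
    (fun a : Fin (M k) × Fin (M (k + 1)) => Function.update (Function.update m k a.1) (k + 1) a.2)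
    (fun a => a.1 ≠ m k ∧ a.2 ≠ m (k + 1))
    (fun x z => ind (ch.output k z = ch.output k x)) (fun _ _ => ind_nonneg _) ?_
    θ.outGivenSnd_nonneg ?_).trans_eq (by simp)
  · rintro c - ⟨m', hm', h1, h2⟩
    refine ⟨(m' k, m' (k + 1)), ⟨hm'.1, h1⟩, ?_⟩
    simp only [update_two_eq (fin_three_add_one_ne k) (fin_three_cases k) h2]
    rw [ind_of_true hm'.2.1]
  · rintro a ⟨ha, hb⟩ x hx
    refine le_trans (prodExp_mono hp fun z => ?_) hx.2.1
    rw [ite_update_two (fin_three_add_one_ne k) (fin_three_add_two_ne k)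
      (fin_three_add_two_ne_add_one k) (fin_three_cases k) m ha hb]

/-- The messages of users `k` and `k + 2` are wrong, counted by messages. -/
lemma snd_wrong_le :
    codebookProb p (fun c => ch.OutputTypical p k θ (codewords c m) ∧
      ∃ m', ch.Competes p k θ c m m' ∧ m' (k + 1) = m (k + 1) ∧ m' (k + 2) ≠ m (k + 2))
      ≤ M k * M (k + 2) * θ.outGivenFst := by
  have hc (i : Fin 3) : i = k ∨ i = k + 2 ∨ i = k + 1 := by
    rcases fin_three_cases k i with h | h | h <;> simp [h]
  refine (codebookProb_and_le hp (T := ch.OutputTypical p k θ)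
    (fun a : Fin (M k) × Fin (M (k + 2)) => Function.update (Function.update m k a.1) (k + 2) a.2)
    (fun a => a.1 ≠ m k ∧ a.2 ≠ m (k + 2))
    (fun x z => ind (ch.output k z = ch.output k x)) (fun _ _ => ind_nonneg _) ?_
    θ.outGivenFst_nonneg ?_).trans_eq (by simp)
  · rintro c - ⟨m', hm', h1, h2⟩
    refine ⟨(m' k, m' (k + 2)), ⟨hm'.1, h2⟩, ?_⟩
    simp only [update_two_eq (fin_three_add_two_ne k) hc h1]
    rw [ind_of_true hm'.2.1]
  · rintro a ⟨ha, hb⟩ x hx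
    refine le_trans (prodExp_mono hp fun z => ?_) hx.2.2.1
    rw [ite_update_two (fin_three_add_two_ne k) (fin_three_add_one_ne k)
      (fin_three_add_two_ne_add_one k).symm hc m ha hb]

/-- All messages are wrong, counted by messages. -/
lemma all_wrong_le :
    codebookProb p (fun c => ch.OutputTypical p k θ (codewords c m) ∧
      ∃ m', ch.Competes p k θ c m m' ∧ m' (k + 1) ≠ m (k + 1) ∧ m' (k + 2) ≠ m (k + 2))
      ≤ M k * (M (k + 1) * M (k + 2)) * θ.out := by
  refine (codebookProb_and_le hp (T := ch.OutputTypical p k θ)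
    (fun m' : ∀ i, Fin (M i) => m') (fun m' => ∀ i, m' i ≠ m i)
    (fun x z => ind (ch.output k z = ch.output k x)) (fun _ _ => ind_nonneg _) ?_
    θ.out_nonneg ?_).trans_eq
      (by simp [fin_three_prod k fun i => (M i : ℝ)])
  · rintro c - ⟨m', hm', h1, h2⟩
    refine ⟨m', fun i => ?_, ?_⟩
    · rcases fin_three_cases k i with h | h | h
      · exact h ▸ hm'.1
      · exact h ▸ h1
      · exact h ▸ h2
    · rw [ind_of_true hm'.2.1]
  · rintro m' hm' x hx
    refine le_trans (prodExp_mono hp fun z => ?_) hx.2.2.2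
    simp [hm']

variable [∀ l k, Fintype (L l k)]

/-- The messages of users `k` and `k + 1` are wrong, the latter counted by typical values
of `X_{k+1,k}`. -/
lemma fst_wrong_le_count :
    codebookProb p (fun c => ch.OutputTypical p k θ (codewords c m) ∧
      ∃ m', ch.Competes p k θ c m m' ∧ m' (k + 1) ≠ m (k + 1) ∧ m' (k + 2) = m (k + 2))
      ≤ M k * θ.fst * θ.outGivenSnd := by
  refine (codebookProb_and_le hp (T := ch.OutputTypical p k θ)
    (fun a : Fin (M k) => Function.update m k a) (fun a => a ≠ m k)
    (fun x z => ∑ b, ind (1 ≤ θ.fst * law p (fun z => ch.g (k + 1) k (z (k + 1))) b) *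
      ind (ch.f k (ch.g k k (z k)) (ch.h k b (ch.g (k + 2) k (x (k + 2)))) = ch.output k x))
    (fun _ _ => Finset.sum_nonneg fun _ _ => mul_nonneg (ind_nonneg _) (ind_nonneg _)) ?_
    (mul_nonneg θ.fst_nonneg θ.outGivenSnd_nonneg) ?_).trans_eq (by simp [mul_assoc])
  · rintro c - ⟨m', hm', h1, h2⟩
    refine ⟨m' k, hm'.1, le_trans ?_ (Finset.single_le_sum
      (fun _ _ => mul_nonneg (ind_nonneg _) (ind_nonneg _))
      (Finset.mem_univ (ch.g (k + 1) k (c (k + 1) (m' (k + 1))))))⟩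
    have ho := hm'.2.1
    rw [output_eq ch k (codewords c m')] at ho
    simp only [codewords, h2] at ho
    have ht := hm'.2.2.1
    simp only [codewords] at ht ⊢
    rw [ind_of_true ht, ind_of_true, mul_one]
    simpa using ho
  · rintro a ha x hx
    calc _ ≤ prodExp p fun z => θ.fst * prodExp p fun z' =>
          ind (ch.f k (ch.g k k (z k)) (ch.h k (ch.g (k + 1) k (z' (k + 1)))
            (ch.g (k + 2) k (x (k + 2)))) = ch.output k x) := by
          refine prodExp_mono hp fun z => ?_
          rw [ite_update_one k m ha, Function.update_self]
          exact sum_typical_le hp (fun z => ch.g (k + 1) k (z (k + 1)))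
            (ψ := fun b => ind (ch.f k (ch.g k k (z k))
              (ch.h k b (ch.g (k + 2) k (x (k + 2)))) = ch.output k x))
            (fun _ => ind_nonneg _) θ.fst_nonneg
      _ = θ.fst * law p (fun z => ch.output k (Function.update z (k + 2) (x (k + 2))))
            (ch.output k x) := by
          rw [prodExp_const_mul, law]
          congr 1
          conv_rhs => rw [← prodExp_update hp (k + 1)]
          simp only [output_update_snd]
          simp
      _ ≤ _ := mul_le_mul_of_nonneg_left hx.2.1 θ.fst_nonneg

/-- The messages of users `k` and `k + 2` are wrong, the latter counted by typical values
of `X_{k+2,k}`. -/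
lemma snd_wrong_le_count :
    codebookProb p (fun c => ch.OutputTypical p k θ (codewords c m) ∧
      ∃ m', ch.Competes p k θ c m m' ∧ m' (k + 1) = m (k + 1) ∧ m' (k + 2) ≠ m (k + 2))
      ≤ M k * θ.snd * θ.outGivenFst := by
  refine (codebookProb_and_le hp (T := ch.OutputTypical p k θ)
    (fun a : Fin (M k) => Function.update m k a) (fun a => a ≠ m k)
    (fun x z => ∑ b, ind (1 ≤ θ.snd * law p (fun z => ch.g (k + 2) k (z (k + 2))) b) *
      ind (ch.f k (ch.g k k (z k)) (ch.h k (ch.g (k + 1) k (x (k + 1))) b) = ch.output k x))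
    (fun _ _ => Finset.sum_nonneg fun _ _ => mul_nonneg (ind_nonneg _) (ind_nonneg _)) ?_
    (mul_nonneg θ.snd_nonneg θ.outGivenFst_nonneg) ?_).trans_eq (by simp [mul_assoc])
  · rintro c - ⟨m', hm', h1, h2⟩
    refine ⟨m' k, hm'.1, le_trans ?_ (Finset.single_le_sum
      (fun _ _ => mul_nonneg (ind_nonneg _) (ind_nonneg _))
      (Finset.mem_univ (ch.g (k + 2) k (c (k + 2) (m' (k + 2))))))⟩
    have ho := hm'.2.1
    rw [output_eq ch k (codewords c m')] at ho
    simp only [codewords, h1] at ho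
    have ht := hm'.2.2.2.1
    simp only [codewords] at ht ⊢
    rw [ind_of_true ht, ind_of_true, mul_one]
    simpa using ho
  · rintro a ha x hx
    calc _ ≤ prodExp p fun z => θ.snd * prodExp p fun z' =>
          ind (ch.f k (ch.g k k (z k)) (ch.h k (ch.g (k + 1) k (x (k + 1)))
            (ch.g (k + 2) k (z' (k + 2)))) = ch.output k x) := by
          refine prodExp_mono hp fun z => ?_
          rw [ite_update_one k m ha, Function.update_self]
          exact sum_typical_le hp (fun z => ch.g (k + 2) k (z (k + 2)))
            (ψ := fun b => ind (ch.f k (ch.g k k (z k))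
              (ch.h k (ch.g (k + 1) k (x (k + 1))) b) = ch.output k x))
            (fun _ => ind_nonneg _) θ.snd_nonneg
      _ = θ.snd * law p (fun z => ch.output k (Function.update z (k + 1) (x (k + 1))))
            (ch.output k x) := by
          rw [prodExp_const_mul, law]
          congr 1
          conv_rhs => rw [← prodExp_update hp (k + 2)]
          simp only [output_update_fst]
          simp
      _ ≤ _ := mul_le_mul_of_nonneg_left hx.2.2.1 θ.snd_nonneg

/-- All messages are wrong, those of user `k + 2` counted by typical values of `X_{k+2,k}`. -/
lemma all_wrong_le_count_snd :
    codebookProb p (fun c => ch.OutputTypical p k θ (codewords c m) ∧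
      ∃ m', ch.Competes p k θ c m m' ∧ m' (k + 1) ≠ m (k + 1) ∧ m' (k + 2) ≠ m (k + 2))
      ≤ M k * (M (k + 1) * θ.snd) * θ.out := by
  refine (codebookProb_and_le hp (T := ch.OutputTypical p k θ)
    (fun a : Fin (M k) × Fin (M (k + 1)) => Function.update (Function.update m k a.1) (k + 1) a.2)
    (fun a => a.1 ≠ m k ∧ a.2 ≠ m (k + 1))
    (fun x z => ∑ b, ind (1 ≤ θ.snd * law p (fun z => ch.g (k + 2) k (z (k + 2))) b) *
      ind (ch.f k (ch.g k k (z k)) (ch.h k (ch.g (k + 1) k (z (k + 1))) b) = ch.output k x))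
    (fun _ _ => Finset.sum_nonneg fun _ _ => mul_nonneg (ind_nonneg _) (ind_nonneg _)) ?_
    (mul_nonneg θ.snd_nonneg θ.out_nonneg) ?_).trans_eq (by simp [mul_assoc])
  · rintro c - ⟨m', hm', h1, h2⟩
    refine ⟨(m' k, m' (k + 1)), ⟨hm'.1, h1⟩, le_trans ?_ (Finset.single_le_sum
      (fun _ _ => mul_nonneg (ind_nonneg _) (ind_nonneg _))
      (Finset.mem_univ (ch.g (k + 2) k (c (k + 2) (m' (k + 2))))))⟩
    have ho := hm'.2.1
    rw [output_eq ch k (codewords c m')] at ho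
    simp only [codewords] at ho
    have ht := hm'.2.2.2.1
    simp only [codewords] at ht ⊢
    rw [ind_of_true ht, ind_of_true, mul_one]
    simpa using ho
  · rintro a ⟨ha, hb⟩ x hx
    calc _ ≤ prodExp p fun z => θ.snd * prodExp p fun z' =>
          ind (ch.f k (ch.g k k (z k)) (ch.h k (ch.g (k + 1) k (z (k + 1)))
            (ch.g (k + 2) k (z' (k + 2)))) = ch.output k x) := by
          refine prodExp_mono hp fun z => ?_
          rw [ite_update_two (fin_three_add_one_ne k) (fin_three_add_two_ne k)
            (fin_three_add_two_ne_add_one k) (fin_three_cases k) m ha hb,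
            Function.update_of_ne (fin_three_add_two_ne k).symm,
            Function.update_of_ne (fin_three_add_two_ne_add_one k).symm]
          exact sum_typical_le hp (fun z => ch.g (k + 2) k (z (k + 2)))
            (ψ := fun b => ind (ch.f k (ch.g k k (z k))
              (ch.h k (ch.g (k + 1) k (z (k + 1))) b) = ch.output k x))
            (fun _ => ind_nonneg _) θ.snd_nonneg
      _ = θ.snd * law p (ch.output k) (ch.output k x) := by
          rw [prodExp_const_mul, law]
          congr 1
          conv_rhs => rw [← prodExp_update hp (k + 2)]
          simp only [output_update_snd]
      _ ≤ _ := mul_le_mul_of_nonneg_left hx.2.2.2 θ.snd_nonneg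

/-- All messages are wrong, those of user `k + 1` counted by typical values of `X_{k+1,k}`. -/
lemma all_wrong_le_count_fst :
    codebookProb p (fun c => ch.OutputTypical p k θ (codewords c m) ∧
      ∃ m', ch.Competes p k θ c m m' ∧ m' (k + 1) ≠ m (k + 1) ∧ m' (k + 2) ≠ m (k + 2))
      ≤ M k * (θ.fst * M (k + 2)) * θ.out := by
  have hc (i : Fin 3) : i = k ∨ i = k + 2 ∨ i = k + 1 := by
    rcases fin_three_cases k i with h | h | h <;> simp [h]
  refine (codebookProb_and_le hp (T := ch.OutputTypical p k θ)
    (fun a : Fin (M k) × Fin (M (k + 2)) => Function.update (Function.update m k a.1) (k + 2) a.2)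
    (fun a => a.1 ≠ m k ∧ a.2 ≠ m (k + 2))
    (fun x z => ∑ b, ind (1 ≤ θ.fst * law p (fun z => ch.g (k + 1) k (z (k + 1))) b) *
      ind (ch.f k (ch.g k k (z k)) (ch.h k b (ch.g (k + 2) k (z (k + 2)))) = ch.output k x))
    (fun _ _ => Finset.sum_nonneg fun _ _ => mul_nonneg (ind_nonneg _) (ind_nonneg _)) ?_
    (mul_nonneg θ.fst_nonneg θ.out_nonneg) ?_).trans_eq
      (by simp only [Fintype.card_prod, Fintype.card_fin, Nat.cast_mul]; ring)
  · rintro c - ⟨m', hm', h1, h2⟩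
    refine ⟨(m' k, m' (k + 2)), ⟨hm'.1, h2⟩, le_trans ?_ (Finset.single_le_sum
      (fun _ _ => mul_nonneg (ind_nonneg _) (ind_nonneg _))
      (Finset.mem_univ (ch.g (k + 1) k (c (k + 1) (m' (k + 1))))))⟩
    have ho := hm'.2.1
    rw [output_eq ch k (codewords c m')] at ho
    simp only [codewords] at ho
    have ht := hm'.2.2.1
    simp only [codewords] at ht ⊢
    rw [ind_of_true ht, ind_of_true, mul_one]
    simpa using ho
  · rintro a ⟨ha, hb⟩ x hx
    calc _ ≤ prodExp p fun z => θ.fst * prodExp p fun z' =>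
          ind (ch.f k (ch.g k k (z k)) (ch.h k (ch.g (k + 1) k (z' (k + 1)))
            (ch.g (k + 2) k (z (k + 2)))) = ch.output k x) := by
          refine prodExp_mono hp fun z => ?_
          rw [ite_update_two (fin_three_add_two_ne k) (fin_three_add_one_ne k)
            (fin_three_add_two_ne_add_one k).symm hc m ha hb,
            Function.update_of_ne (fin_three_add_one_ne k).symm,
            Function.update_of_ne (fin_three_add_two_ne_add_one k)]
          exact sum_typical_le hp (fun z => ch.g (k + 1) k (z (k + 1)))
            (ψ := fun b => ind (ch.f k (ch.g k k (z k))
              (ch.h k b (ch.g (k + 2) k (z (k + 2)))) = ch.output k x))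
            (fun _ => ind_nonneg _) θ.fst_nonneg
      _ = θ.fst * law p (ch.output k) (ch.output k x) := by
          rw [prodExp_const_mul, law]
          congr 1
          conv_rhs => rw [← prodExp_update hp (k + 1)]
          simp only [output_update_fst]
      _ ≤ _ := mul_le_mul_of_nonneg_left hx.2.2.2 θ.fst_nonneg

omit [∀ l k, Fintype (L l k)] in
/-- All messages are wrong, those of the interferers counted jointly by typical values of `S_k`. -/
lemma all_wrong_le_count_sum [∀ k, Fintype (S k)] :
    codebookProb p (fun c => ch.OutputTypical p k θ (codewords c m) ∧
      ∃ m', ch.Competes p k θ c m m' ∧ m' (k + 1) ≠ m (k + 1) ∧ m' (k + 2) ≠ m (k + 2))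
      ≤ M k * θ.sum * θ.out := by
  refine (codebookProb_and_le hp (T := ch.OutputTypical p k θ)
    (fun a : Fin (M k) => Function.update m k a) (fun a => a ≠ m k)
    (fun x z => ∑ s, ind (1 ≤ θ.sum * law p (ch.interference k) s) *
      ind (ch.f k (ch.g k k (z k)) s = ch.output k x))
    (fun _ _ => Finset.sum_nonneg fun _ _ => mul_nonneg (ind_nonneg _) (ind_nonneg _)) ?_
    (mul_nonneg θ.sum_nonneg θ.out_nonneg) ?_).trans_eq (by simp [mul_assoc])
  · rintro c - ⟨m', hm', h1, h2⟩
    refine ⟨m' k, hm'.1, le_trans ?_ (Finset.single_le_sum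
      (fun _ _ => mul_nonneg (ind_nonneg _) (ind_nonneg _))
      (Finset.mem_univ (ch.interference k (codewords c m'))))⟩
    have ho := hm'.2.1
    have ht := hm'.2.2.2.2
    rw [ind_of_true ht, ind_of_true, mul_one]
    rw [← ho]
    simp [codewords, output]
  · rintro a ha x hx
    calc _ ≤ prodExp p fun z => θ.sum * prodExp p fun z' =>
          ind (ch.f k (ch.g k k (z k)) (ch.interference k z') = ch.output k x) := by
          refine prodExp_mono hp fun z => ?_
          rw [ite_update_one k m ha, Function.update_self]
          exact sum_typical_le hp (ch.interference k)
            (ψ := fun s => ind (ch.f k (ch.g k k (z k)) s = ch.output k x))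
            (fun _ => ind_nonneg _) θ.sum_nonneg
      _ = θ.sum * law p (ch.output k) (ch.output k x) := by
          rw [prodExp_const_mul, law, prodExp_comm]
          congr 1
          conv_rhs => rw [← prodExp_update hp k]
          simp only [output_update_self]
      _ ≤ _ := mul_le_mul_of_nonneg_left hx.2.2.2 θ.sum_nonneg

end Receiver

end ThreeDIC

/-! ### The one-shot random coding bound -/

namespace ThreeDIC

section OneShot

variable {X Y S : Fin 3 → Type*} {L : Fin 3 → Fin 3 → Type*} [∀ k, Fintype (X k)]
  [∀ k, Fintype (S k)] [∀ l k, Fintype (L l k)]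

/-- The bound on the probability that some message triple competes with the transmitted one at
receiver `k`. Each minimum is over the ways to count the interference: by the messages of
an interferer or by its typical values. -/
def competitionBound (M : Fin 3 → ℕ) (k : Fin 3) (θ : Thresholds) : ℝ :=
  M k * θ.desired + M k * min (M (k + 1) : ℝ) θ.fst * θ.outGivenSnd +
    M k * min (M (k + 2) : ℝ) θ.snd * θ.outGivenFst +
    M k * min ((M (k + 1) : ℝ) * M (k + 2)) (min ((M (k + 1) : ℝ) * θ.snd)
      (min (θ.fst * M (k + 2)) θ.sum)) * θ.out

lemma competes_le (ch : ThreeDIC X Y S L) {p : ∀ k, X k → ℝ}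
    (hp : ∀ k, p k ∈ stdSimplex ℝ (X k)) {M : Fin 3 → ℕ} (k : Fin 3) (θ : Thresholds)
    (m : ∀ k, Fin (M k)) :
    codebookProb p (fun c => ch.OutputTypical p k θ (codewords c m) ∧
      ∃ m', ch.Competes p k θ c m m') ≤ competitionBound M k θ := by
  refine (codebookProb_mono hp (F := fun c =>
    (((ch.OutputTypical p k θ (codewords c m) ∧
      ∃ m', ch.Competes p k θ c m m' ∧ m' (k + 1) = m (k + 1) ∧ m' (k + 2) = m (k + 2)) ∨
    (ch.OutputTypical p k θ (codewords c m) ∧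
      ∃ m', ch.Competes p k θ c m m' ∧ m' (k + 1) ≠ m (k + 1) ∧ m' (k + 2) = m (k + 2))) ∨
    (ch.OutputTypical p k θ (codewords c m) ∧
      ∃ m', ch.Competes p k θ c m m' ∧ m' (k + 1) = m (k + 1) ∧ m' (k + 2) ≠ m (k + 2))) ∨
    (ch.OutputTypical p k θ (codewords c m) ∧
      ∃ m', ch.Competes p k θ c m m' ∧ m' (k + 1) ≠ m (k + 1) ∧ m' (k + 2) ≠ m (k + 2)))
    ?_).trans ?_
  · rintro c ⟨h, m', hm'⟩
    by_cases h1 : m' (k + 1) = m (k + 1) <;> by_cases h2 : m' (k + 2) = m (k + 2)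
    · exact Or.inl (Or.inl (Or.inl ⟨h, m', hm', h1, h2⟩))
    · exact Or.inl (Or.inr ⟨h, m', hm', h1, h2⟩)
    · exact Or.inl (Or.inl (Or.inr ⟨h, m', hm', h1, h2⟩))
    · exact Or.inr ⟨h, m', hm', h1, h2⟩
  · refine (codebookProb_or_le hp _ _).trans (add_le_add ?_ ?_)
    · refine (codebookProb_or_le hp _ _).trans (add_le_add ?_ ?_)
      · refine (codebookProb_or_le hp _ _).trans (add_le_add ?_ ?_)
        · exact ch.desired_wrong_le hp k θ m
        · rcases min_choice (M (k + 1) : ℝ) θ.fst with h | h <;> rw [h]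
          · exact ch.fst_wrong_le hp k θ m
          · exact ch.fst_wrong_le_count hp k θ m
      · rcases min_choice (M (k + 2) : ℝ) θ.snd with h | h <;> rw [h]
        · exact ch.snd_wrong_le hp k θ m
        · exact ch.snd_wrong_le_count hp k θ m
    · rcases min_choice ((M (k + 1) : ℝ) * M (k + 2)) (min ((M (k + 1) : ℝ) * θ.snd)
        (min (θ.fst * M (k + 2)) θ.sum)) with h | h <;> rw [h]
      · exact ch.all_wrong_le hp k θ m
      · rcases min_choice ((M (k + 1) : ℝ) * θ.snd) (min (θ.fst * M (k + 2)) θ.sum)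
          with h | h <;> rw [h]
        · exact ch.all_wrong_le_count_snd hp k θ m
        · rcases min_choice (θ.fst * M (k + 2)) θ.sum with h | h <;> rw [h]
          · exact ch.all_wrong_le_count_fst hp k θ m
          · exact ch.all_wrong_le_count_sum hp k θ m

/-- All signals at receiver `k` are typical. -/
def Typical (ch : ThreeDIC X Y S L) (p : ∀ k, X k → ℝ) (k : Fin 3) (θ : Thresholds)
    (x : ∀ k, X k) : Prop :=
  ch.OutputTypical p k θ x ∧ ch.InterferenceTypical p k θ x

omit [∀ k, Fintype (S k)] [∀ l k, Fintype (L l k)] in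
/-- Decoding by consistency: for every codebook there are decoders that recover `m` unless a
signal is atypical or another message triple competes with `m`. Receiver `k` takes the message of
user `k` from any message triple whose interference is typical and that explains the received
signal. -/
lemma exists_decoder (ch : ThreeDIC X Y S L) (p : ∀ k, X k → ℝ) {M : Fin 3 → ℕ}
    (θ : Fin 3 → Thresholds) (c : ∀ k, Fin (M k) → X k) :
    ∃ dec : ∀ k, Y k → Option (Fin (M k)), ∀ m,
      (∃ k, dec k (ch.output k (codewords c m)) ≠ some (m k)) →
      (∃ k, ¬ ch.Typical p k (θ k) (codewords c m)) ∨
      ∃ k, ch.OutputTypical p k (θ k) (codewords c m) ∧ ∃ m', ch.Competes p k (θ k) c m m' := by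
  classical
  let good : ∀ k, Y k → (∀ k, Fin (M k)) → Prop := fun k y m' =>
    ch.output k (codewords c m') = y ∧ ch.InterferenceTypical p k (θ k) (codewords c m')
  refine ⟨fun k y => if h : ∃ m, good k y m then some (h.choose k) else none, ?_⟩
  rintro m ⟨k, hk⟩
  by_contra! hcon
  have hT := hcon.1 k
  have hm : ∃ m', good k (ch.output k (codewords c m)) m' := ⟨m, rfl, hT.2⟩
  beta_reduce at hk
  rw [dif_pos hm] at hk
  exact hcon.2 k hT.1 hm.choose
    ⟨fun h => hk (congrArg some h), hm.choose_spec.1, hm.choose_spec.2⟩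

lemma exists_le_of_weighted_sum_le {Ω : Type*} [Fintype Ω] {w : Ω → ℝ} (hw : w ∈ stdSimplex ℝ Ω)
    {φ : Ω → ℝ} {B : ℝ} (h : ∑ x, w x * φ x ≤ B) : ∃ x, φ x ≤ B := by
  by_contra! hcon
  have hne : Nonempty Ω := by
    by_contra hΩ
    rw [not_nonempty_iff] at hΩ
    simpa using hw.2
  obtain ⟨x₀, hx₀⟩ := Finite.exists_min φ
  have : φ x₀ ≤ ∑ x, w x * φ x := by
    calc φ x₀ = ∑ x, w x * φ x₀ := by rw [← Finset.sum_mul, hw.2, one_mul]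
      _ ≤ _ := Finset.sum_le_sum fun x _ => mul_le_mul_of_nonneg_left (hx₀ x) (hw.1 x)
  linarith [hcon x₀]

open Classical in
/-- The one-shot random coding bound: averaging over a random time-sharing symbol and a random
codebook, there is a code whose error probability is at most the probability of an atypical
signal plus the competition bounds of the three receivers. -/
theorem exists_code_le {Q : Type*} [Fintype Q] (ch : ThreeDIC X Y S L) (P : InputDist X Q)
    (M : Fin 3 → ℕ) (hM : ∀ k, 0 < M k) (θ : Fin 3 → Thresholds) :
    ∃ (c : ∀ k, Fin (M k) → X k) (dec : ∀ k, Y k → Option (Fin (M k))),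
      ((Finset.univ.filter fun m : ∀ j, Fin (M j) =>
        ∃ k, dec k (ch.output k (codewords c m)) ≠ some (m k)).card : ℝ) / ∏ j, (M j : ℝ) ≤
      (∑ q, P.pQ q * prodExp (fun k => P.pX k q) fun x =>
        ind (∃ k, ¬ ch.Typical (fun k => P.pX k q) k (θ k) x)) +
      ∑ k, competitionBound M k (θ k) := by
  set A : Q → ℝ := fun q => prodExp (fun k => P.pX k q) fun x =>
        ind (∃ k, ¬ ch.Typical (fun k => P.pX k q) k (θ k) x) with hA
  obtain ⟨q, hq⟩ : ∃ q, A q + ∑ k, competitionBound M k (θ k) ≤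
      (∑ q, P.pQ q * A q) + ∑ k, competitionBound M k (θ k) := by
    refine exists_le_of_weighted_sum_le P.pQ_mem (le_of_eq ?_)
    simp only [mul_add, Finset.sum_add_distrib]
    rw [← Finset.sum_mul, P.pQ_mem.2, one_mul]
  set p : ∀ k, X k → ℝ := fun k => P.pX k q with hpdef
  have hp (k : Fin 3) : p k ∈ stdSimplex ℝ (X k) := P.pX_mem k q
  have hMpos : (0 : ℝ) < ∏ j, (M j : ℝ) := Finset.prod_pos fun j _ => by exact_mod_cast hM j
  -- `bad m c` is the event on which the decoders may fail.
  let bad : (∀ k, Fin (M k)) → (∀ k, Fin (M k) → X k) → Prop := fun m c =>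
    (∃ k, ¬ ch.Typical p k (θ k) (codewords c m)) ∨
      ∃ k, ch.OutputTypical p k (θ k) (codewords c m) ∧ ∃ m', ch.Competes p k (θ k) c m m'
  have hbad (m : ∀ k, Fin (M k)) : codebookProb p (bad m) ≤
      A q + ∑ k, competitionBound M k (θ k) := by
    refine (codebookProb_or_le hp _ _).trans (add_le_add (le_of_eq ?_) ?_)
    · exact codebookExp_single hp m fun x => ind (∃ k, ¬ ch.Typical p k (θ k) x)
    · refine le_trans (codebookExp_mono hp (ψ := fun c => ∑ k, ind
        (ch.OutputTypical p k (θ k) (codewords c m) ∧ ∃ m', ch.Competes p k (θ k) c m m'))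
        fun c => ?_) ?_
      · by_cases h : ∃ k, ch.OutputTypical p k (θ k) (codewords c m) ∧
          ∃ m', ch.Competes p k (θ k) c m m'
        · obtain ⟨k, hk⟩ := h
          refine (ind_le_one _).trans ((ind_of_true hk).symm.le.trans ?_)
          exact Finset.single_le_sum (f := fun k => ind
            (ch.OutputTypical p k (θ k) (codewords c m) ∧ ∃ m', ch.Competes p k (θ k) c m m'))
            (fun _ _ => ind_nonneg _) (Finset.mem_univ k)
        · rw [ind_of_false h]
          exact Finset.sum_nonneg fun _ _ => ind_nonneg _
      · rw [codebookExp, prodExp_sum]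
        exact Finset.sum_le_sum fun k _ => ch.competes_le hp k (θ k) m
  obtain ⟨c, hc⟩ : ∃ c : ∀ k, Fin (M k) → X k,
      (∑ m, ind (bad m c)) / ∏ j, (M j : ℝ) ≤ A q + ∑ k, competitionBound M k (θ k) := by
    refine exists_le_of_weighted_sum_le
      (prod_mem_stdSimplex (codebook_weight_mem_stdSimplex hp)) ?_
    calc _ = (∑ m, codebookProb p (bad m)) / ∏ j, (M j : ℝ) := by
          simp only [codebookProb, codebookExp]
          rw [← prodExp_sum, div_eq_mul_inv, ← prodExp_mul_const]
          rfl
      _ ≤ (∑ _m : ∀ j, Fin (M j), (A q + ∑ k, competitionBound M k (θ k))) / ∏ j, (M j : ℝ) :=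
          div_le_div_of_nonneg_right (Finset.sum_le_sum fun m _ => hbad m) hMpos.le
      _ = _ := by
          rw [Finset.sum_const, Finset.card_univ, Fintype.card_pi]
          simp only [Fintype.card_fin, nsmul_eq_mul, Nat.cast_prod]
          rw [mul_comm, mul_div_assoc, div_self hMpos.ne', mul_one]
  obtain ⟨dec, hdec⟩ := ch.exists_decoder p θ c
  refine ⟨c, dec, le_trans (div_le_div_of_nonneg_right ?_ hMpos.le) (hc.trans hq)⟩
  rw [Finset.card_filter]
  push_cast
  refine Finset.sum_le_sum fun m _ => ?_
  split_ifs with h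
  · rw [ind_of_true (hdec m h)]
  · exact ind_nonneg _

end OneShot

end ThreeDIC

/-! ### Conditional entropies as means over the time-sharing symbol -/

section Entropy

/-- The entropy of `F x z` given what it uses of `x`, when `x` and `z` are independent inputs with
pmf `p`: the mean of `-log₂` of the probability of the value `F x x` of `F x`. Taking `F x z` to
be `Y_k` for the input `z` with coordinate `l` replaced by `x l` gives the entropy of `Y_k`
given `X_{lk}`; an `F` that ignores `x` gives an unconditional entropy. -/
noncomputable def selfEntropy {X : Fin 3 → Type*} [∀ k, Fintype (X k)] {α : Type*}
    (F : (∀ k, X k) → (∀ k, X k) → α) (p : ∀ k, X k → ℝ) : ℝ :=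
  -prodExp p fun x => Real.logb 2 (law p (F x) (F x x))

lemma sum_marginal_mul {Ω γ : Type*} [Fintype Ω] [Fintype γ] (p : Ω → ℝ) (C : Ω → γ)
    (ψ : γ → ℝ) : ∑ c, marginal p C c * ψ c = ∑ ω, p ω * ψ (C ω) := by
  classical
  simp only [marginal, Finset.sum_mul]
  rw [Finset.sum_comm]
  simp

lemma condEntropy_eq_of_kernel {Ω α β : Type*} [Fintype Ω] [Fintype α] [Fintype β] {p : Ω → ℝ}
    (hp : ∀ ω, 0 ≤ p ω) (A : Ω → α) (B : Ω → β) (κ : Ω → ℝ)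
    (h : ∀ ω, marginal p (fun ω => (A ω, B ω)) (A ω, B ω) = κ ω * marginal p B (B ω)) :
    condEntropy p A B = -∑ ω, p ω * Real.logb 2 (κ ω) := by
  classical
  rw [condEntropy, ← Fintype.sum_prod_type' (f := fun a b =>
      marginal p (fun ω => (A ω, B ω)) (a, b) *
        Real.logb 2 (marginal p (fun ω => (A ω, B ω)) (a, b) / marginal p B b)),
    sum_marginal_mul p (fun ω => (A ω, B ω)) fun c =>
      Real.logb 2 (marginal p (fun ω => (A ω, B ω)) (c.1, c.2) / marginal p B c.2)]
  congr 1
  refine Finset.sum_congr rfl fun ω _ => ?_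
  by_cases hω : p ω = 0
  · simp [hω]
  -- Where `p ω` is positive, the conditional probability is not a division by zero.
  · have hB : marginal p B (B ω) ≠ 0 := by
      have : p ω ≤ marginal p B (B ω) := by
        have := Finset.single_le_sum (f := fun ω' => if B ω' = B ω then p ω' else 0)
          (fun ω' _ => by
            by_cases hB : B ω' = B ω
            · simpa [hB] using hp ω'
            · simp [hB]) (Finset.mem_univ ω)
        rw [if_pos rfl] at this
        rw [marginal]
        convert this
      exact ne_of_gt (lt_of_lt_of_le (lt_of_le_of_ne (hp ω) (Ne.symm hω)) this)
    rw [h, mul_div_cancel_right₀ _ hB]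

namespace InputDist

variable {X : Fin 3 → Type*} [∀ k, Fintype (X k)] {Q : Type*} [Fintype Q] (P : InputDist X Q)

lemma joint_nonneg (ω : Q × (∀ k, X k)) : 0 ≤ P.joint ω :=
  mul_nonneg (P.pQ_mem.1 _) (Finset.prod_nonneg fun k _ => (P.pX_mem k _).1 _)

lemma sum_joint_mul (φ : Q × (∀ k, X k) → ℝ) :
    ∑ ω, P.joint ω * φ ω = ∑ q, P.pQ q * prodExp (fun k => P.pX k q) fun x => φ (q, x) := by
  simp only [Fintype.sum_prod_type, joint, prodExp, Finset.mul_sum, mul_assoc]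

lemma marginal_joint {γ : Type*} (C : Q × (∀ k, X k) → γ) (c : γ) :
    marginal P.joint C c =
      ∑ q, P.pQ q * prodExp (fun k => P.pX k q) fun x => ind (C (q, x) = c) := by
  rw [← P.sum_joint_mul fun ω => ind (C ω = c)]
  exact Finset.sum_congr rfl fun ω _ => by simp [ind]

/-- The marginal of a variable `C` that amounts to the time-sharing symbol together with a function
`F` of the inputs; `γ'` puts the values of `C` into this form. -/
lemma marginal_joint_pair {γ δ : Type*} (C : Q × (∀ k, X k) → δ) (q : Q) (c : δ) (γ' : δ → γ × Q)
    (hγ : Function.Injective γ') (F : (∀ k, X k) → γ) (a : γ) (hc : γ' c = (a, q))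
    (hC : ∀ ω, γ' (C ω) = (F ω.2, ω.1)) :
    marginal P.joint C c = P.pQ q * law (fun k => P.pX k q) F a := by
  classical
  have hiff (ω : Q × (∀ k, X k)) : C ω = c ↔ F ω.2 = a ∧ ω.1 = q := by
    rw [← hγ.eq_iff, hC, hc, Prod.mk.injEq]
  rw [marginal_joint, Finset.sum_eq_single q]
  · simp only [hiff, and_true, law]
  · intro q' _ hq'
    simp only [hiff, hq', and_false]
    simp [ind, prodExp]
  · simp

lemma condEntropy_eq {α β : Type*} [Fintype α] [Fintype β] (A : Q × (∀ k, X k) → α)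
    (B : Q × (∀ k, X k) → β) {γ : Type*} (F : (∀ k, X k) → (∀ k, X k) → γ)
    (h : ∀ q x, marginal P.joint (fun ω => (A ω, B ω)) (A (q, x), B (q, x)) =
      law (fun k => P.pX k q) (F x) (F x x) * marginal P.joint B (B (q, x))) :
    condEntropy P.joint A B = ∑ q, P.pQ q * selfEntropy F fun k => P.pX k q := by
  rw [condEntropy_eq_of_kernel P.joint_nonneg A B
      (fun ω => law (fun k => P.pX k ω.1) (F ω.2) (F ω.2 ω.2)) fun ω => h ω.1 ω.2,
    P.sum_joint_mul fun ω => Real.logb 2 (law (fun k => P.pX k ω.1) (F ω.2) (F ω.2 ω.2))]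
  simp only [selfEntropy, mul_neg, Finset.sum_neg_distrib]

lemma condEntropy_eq_of_snd {α : Type*} [Fintype α] (A : (∀ k, X k) → α) :
    condEntropy P.joint (fun ω => A ω.2) (fun ω => ω.1) =
      ∑ q, P.pQ q * selfEntropy (fun _ => A) fun k => P.pX k q := by
  refine P.condEntropy_eq _ _ _ fun q x => ?_
  rw [P.marginal_joint_pair _ q _ id Function.injective_id A (A x) rfl fun _ => rfl,
    P.marginal_joint_pair _ q q (fun q => ((), q)) (fun _ _ h => congrArg Prod.snd h)
      (fun _ => ()) () rfl fun _ => rfl]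
  have : law (fun k => P.pX k q) (fun _ => ()) () = 1 := by
    simp only [law, ind_of_true]
    exact prodExp_const (fun k => P.pX_mem k q) 1
  rw [this]
  ring

end InputDist

namespace ThreeDIC

variable {X Y S : Fin 3 → Type*} {L : Fin 3 → Fin 3 → Type*} [∀ k, Fintype (X k)]
  [∀ k, Fintype (Y k)] [∀ k, Fintype (S k)] [∀ l k, Fintype (L l k)] (ch : ThreeDIC X Y S L)
  {Q : Type*} [Fintype Q] (P : InputDist X Q)

omit [∀ k, Fintype (Y k)] [∀ k, Fintype (S k)] in
lemma entLink_eq (l k : Fin 3) : ch.entLink P l k =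
    ∑ q, P.pQ q * selfEntropy (fun _ z => ch.g l k (z l)) fun k => P.pX k q :=
  P.condEntropy_eq_of_snd fun x => ch.g l k (x l)

omit [∀ k, Fintype (Y k)] [∀ l k, Fintype (L l k)] in
lemma entInterference_eq (k : Fin 3) : ch.entInterference P k =
    ∑ q, P.pQ q * selfEntropy (fun _ => ch.interference k) fun k => P.pX k q :=
  P.condEntropy_eq_of_snd (ch.interference k)

omit [∀ k, Fintype (S k)] [∀ l k, Fintype (L l k)] in
lemma entOutput_eq (k : Fin 3) : ch.entOutput P k =
    ∑ q, P.pQ q * selfEntropy (fun _ => ch.output k) fun k => P.pX k q :=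
  P.condEntropy_eq_of_snd (ch.output k)

omit [∀ k, Fintype (S k)] in
lemma entOutputGivenLink_eq (l k : Fin 3) : ch.entOutputGivenLink P l k =
    ∑ q, P.pQ q * selfEntropy (fun x z => ch.output k (Function.update z l (x l)))
      fun k => P.pX k q := by
  refine P.condEntropy_eq _ _ _ fun q x => ?_
  have hp (k : Fin 3) := P.pX_mem k q
  rw [P.marginal_joint_pair _ q _ (fun c => ((c.1, c.2.1), c.2.2))
      (fun c d h => by
        simp only [Prod.mk.injEq] at h
        exact Prod.ext h.1.1 (Prod.ext h.1.2 h.2))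
      (fun z => (ch.output k z, ch.g l k (z l))) (ch.output k x, ch.g l k (x l)) rfl
      fun _ => rfl,
    P.marginal_joint_pair _ q _ id Function.injective_id (fun z => ch.g l k (z l))
      (ch.g l k (x l)) rfl fun _ => rfl, Function.update_eq_self]
  -- Given `X_{lk}`, the output is a function of the inputs of the other users.
  have key : law (fun k => P.pX k q) (fun z => (ch.output k z, ch.g l k (z l)))
        (ch.output k x, ch.g l k (x l)) =
      law (fun k => P.pX k q) (fun z => ch.output k (Function.update z l (x l)))
        (ch.output k x) *
      law (fun k => P.pX k q) (fun z => ch.g l k (z l)) (ch.g l k (x l)) := by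
    rw [law, law, law, ← prodExp_mul_of_indep hp l
      (φ := fun z => ind (ch.output k (Function.update z l (x l)) = ch.output k x))
      (ψ := fun a => ind (ch.g l k a = ch.g l k (x l))) (fun z a => by simp)]
    congr 1
    funext z
    by_cases h : ch.g l k (z l) = ch.g l k (x l)
    · have : ch.output k z = ch.output k (Function.update z l (x l)) := by
        refine ch.output_congr k fun i => ?_
        by_cases hi : i = l
        · subst hi; simpa using h
        · simp [hi]
      rw [ind_of_true h, mul_one, Prod.mk.injEq, this]
      simp [h]
    · rw [ind_of_false h, mul_zero, ind_of_false]
      exact fun hz => h (congrArg Prod.snd hz)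
  rw [key]
  ring

end ThreeDIC

end Entropy

/-! ### Blocks of independent symbols -/

/-- If `φ` has negative mean, then its exponential moment at some `s > 0` is below one. -/
lemma exists_exp_moment_lt_one {Ω : Type*} [Fintype Ω] {w : Ω → ℝ} (hw : w ∈ stdSimplex ℝ Ω)
    {φ : Ω → ℝ} (hφ : ∑ ω, w ω * φ ω < 0) :
    ∃ s : ℝ, 0 < s ∧ ∑ ω, w ω * Real.exp (s * φ ω) < 1 := by
  have hd : HasDerivAt (fun s : ℝ => ∑ ω, w ω * Real.exp (s * φ ω)) (∑ ω, w ω * φ ω) 0 := by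
    refine HasDerivAt.fun_sum fun ω _ => ?_
    simpa using (((hasDerivAt_id (0 : ℝ)).mul_const (φ ω)).exp).const_mul (w ω)
  have h0 : ∑ ω, w ω * Real.exp (0 * φ ω) = 1 := by simpa using hw.2
  have hlt := (hasDerivAt_iff_tendsto_slope.1 hd).eventually (gt_mem_nhds hφ)
  have hlt' : ∀ᶠ s in 𝓝[>] (0 : ℝ), slope (fun s : ℝ => ∑ ω, w ω * Real.exp (s * φ ω)) 0 s < 0 :=
    hlt.filter_mono (nhdsWithin_mono _ fun s (hs : 0 < s) => hs.ne')
  obtain ⟨s, hs, hs0⟩ := (hlt'.and self_mem_nhdsWithin).exists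
  refine ⟨s, hs0, ?_⟩
  rw [slope_def_field, h0, sub_zero, div_neg_iff] at hs
  rcases hs with ⟨-, h⟩ | ⟨h, -⟩
  · exact absurd h (not_lt.2 (le_of_lt hs0))
  · linarith

section Block

variable {X : Fin 3 → Type*} [∀ k, Fintype (X k)] {Q : Type*} [Fintype Q]

/-- The `n`-fold product of an input distribution. -/
noncomputable def InputDist.pow (P : InputDist X Q) (n : ℕ) :
    InputDist (fun k => Fin n → X k) (Fin n → Q) where
  pQ q := ∏ t, P.pQ (q t)
  pX k q x := ∏ t, P.pX k (q t) (x t)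
  pQ_mem := prod_mem_stdSimplex fun _ => P.pQ_mem
  pX_mem k q := prod_mem_stdSimplex fun t => P.pX_mem k (q t)

/-- The probability of the event `E` for a block of `n` independent input symbols with their
time-sharing symbols. -/
noncomputable def blockProb (P : InputDist X Q) (n : ℕ)
    (E : (Fin n → Q) → (∀ k, Fin n → X k) → Prop) : ℝ :=
  ∑ q, (P.pow n).pQ q * prodExp (fun k => (P.pow n).pX k q) fun x => ind (E q x)

lemma blockProb_nonneg (P : InputDist X Q) (n : ℕ)
    (E : (Fin n → Q) → (∀ k, Fin n → X k) → Prop) : 0 ≤ blockProb P n E :=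
  Finset.sum_nonneg fun q _ => mul_nonneg ((P.pow n).pQ_mem.1 q)
    (prodExp_nonneg (fun k => (P.pow n).pX_mem k q) fun _ => ind_nonneg _)

/-- Events may be compared on blocks of positive probability only. -/
lemma blockProb_mono (P : InputDist X Q) (n : ℕ)
    {E F : (Fin n → Q) → (∀ k, Fin n → X k) → Prop}
    (h : ∀ q x, (∀ t, ∏ k, P.pX k (q t) (x k t) ≠ 0) → E q x → F q x) :
    blockProb P n E ≤ blockProb P n F := by
  refine Finset.sum_le_sum fun q _ => mul_le_mul_of_nonneg_left ?_ ((P.pow n).pQ_mem.1 q)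
  refine Finset.sum_le_sum fun x _ => ?_
  by_cases hx : ∏ k, (P.pow n).pX k q (x k) = 0
  · simp [hx]
  · refine mul_le_mul_of_nonneg_left (ind_mono (h q x fun t h0 => hx ?_))
      ((prod_mem_stdSimplex fun k => (P.pow n).pX_mem k q).1 x)
    simp only [InputDist.pow]
    rw [Finset.prod_comm]
    exact Finset.prod_eq_zero (Finset.mem_univ t) h0

lemma blockProb_exists_le (P : InputDist X Q) (n : ℕ) {J : Type*} [Fintype J]
    (E : J → (Fin n → Q) → (∀ k, Fin n → X k) → Prop) :
    blockProb P n (fun q x => ∃ j, E j q x) ≤ ∑ j, blockProb P n (E j) := by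
  simp only [blockProb]
  rw [Finset.sum_comm]
  refine Finset.sum_le_sum fun q _ => ?_
  rw [← Finset.mul_sum, ← prodExp_sum]
  refine mul_le_mul_of_nonneg_left (prodExp_mono (fun k => (P.pow n).pX_mem k q) fun x => ?_)
    ((P.pow n).pQ_mem.1 q)
  by_cases h : ∃ j, E j q x
  · obtain ⟨j, hj⟩ := h
    exact (ind_le_one _).trans ((ind_of_true hj).symm.le.trans
      (Finset.single_le_sum (f := fun j => ind (E j q x)) (fun _ _ => ind_nonneg _)
        (Finset.mem_univ j)))
  · rw [ind_of_false h]
    exact Finset.sum_nonneg fun _ _ => ind_nonneg _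

/-- A Chernoff bound: sums of independent variables of negative mean are unlikely to be
nonnegative. -/
lemma tendsto_blockProb_sum_nonneg (P : InputDist X Q) {φ : Q → (∀ k, X k) → ℝ}
    (hφ : ∑ q, P.pQ q * prodExp (fun k => P.pX k q) (φ q) < 0) :
    Tendsto (fun n => blockProb P n fun q x => 0 ≤ ∑ t, φ (q t) fun k => x k t)
      atTop (𝓝 0) := by
  have hw : P.joint ∈ stdSimplex ℝ (Q × (∀ k, X k)) := by
    refine ⟨P.joint_nonneg, ?_⟩
    have := P.sum_joint_mul fun _ => 1
    simp only [mul_one, prodExp_const fun k => P.pX_mem k _] at this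
    rw [this, P.pQ_mem.2]
  obtain ⟨s, hs, hs1⟩ := exists_exp_moment_lt_one hw (φ := fun ω => φ ω.1 ω.2)
    (by rwa [P.sum_joint_mul fun ω => φ ω.1 ω.2])
  set r := ∑ ω, P.joint ω * Real.exp (s * φ ω.1 ω.2) with hr
  have hr0 : 0 ≤ r := Finset.sum_nonneg fun ω _ => mul_nonneg (hw.1 ω) (Real.exp_pos _).le
  refine squeeze_zero (fun n => blockProb_nonneg P n _) (fun n => ?_)
    (tendsto_pow_atTop_nhds_zero_of_lt_one hr0 hs1)
  calc _ ≤ ∑ q, (P.pow n).pQ q * prodExp (fun k => (P.pow n).pX k q) fun x =>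
        ∏ t, Real.exp (s * φ (q t) fun k => x k t) := by
        refine Finset.sum_le_sum fun q _ => mul_le_mul_of_nonneg_left
          (prodExp_mono (fun k => (P.pow n).pX_mem k q) fun x => ?_) ((P.pow n).pQ_mem.1 q)
        rw [← Real.exp_sum, ← Finset.mul_sum]
        by_cases h : 0 ≤ ∑ t, φ (q t) fun k => x k t
        · rw [ind_of_true h]
          exact Real.one_le_exp (mul_nonneg hs.le h)
        · rw [ind_of_false h]
          exact (Real.exp_pos _).le
    _ = ∑ q : Fin n → Q, ∏ t, (P.pQ (q t) *
          prodExp (fun k => P.pX k (q t)) fun x => Real.exp (s * φ (q t) x)) := by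
        refine Finset.sum_congr rfl fun q _ => ?_
        rw [Finset.prod_mul_distrib, ← prodExp_pi_prod]
        rfl
    _ = r ^ n := by
        rw [hr, P.sum_joint_mul fun ω => Real.exp (s * φ ω.1 ω.2), Fintype.sum_pow]

lemma prod_eq_two_rpow_sum_logb {J : Type*} [Fintype J] {a : J → ℝ} (ha : ∀ j, 0 < a j) :
    ∏ j, a j = (2 : ℝ) ^ (∑ j, Real.logb 2 (a j)) := by
  rw [Real.rpow_sum_of_pos (by norm_num)]
  exact Finset.prod_congr rfl fun j _ => (Real.rpow_logb (by norm_num) (by norm_num) (ha j)).symm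

/-- With high probability, the probability of the observed block of signals is at most
`2 ^ (-n (H - ε))`. -/
lemma tendsto_blockProb_not_le (P : InputDist X Q) {α : Type*}
    (F : (∀ k, X k) → (∀ k, X k) → α) {H ε : ℝ}
    (hH : H = ∑ q, P.pQ q * selfEntropy F fun k => P.pX k q) (hε : 0 < ε) :
    Tendsto (fun n : ℕ => blockProb P n fun q x => ¬ ∏ t, law (fun k => P.pX k (q t))
      (F fun k => x k t) (F (fun k => x k t) fun k => x k t) ≤ (2 : ℝ) ^ (-(n * (H - ε))))
      atTop (𝓝 0) := by
  refine squeeze_zero (fun n => blockProb_nonneg P n _) (fun n => ?_)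
    (tendsto_blockProb_sum_nonneg P (φ := fun q x =>
      Real.logb 2 (law (fun k => P.pX k q) (F x) (F x x)) + (H - ε)) ?_)
  · refine blockProb_mono P n fun q x hx h => ?_
    rw [prod_eq_two_rpow_sum_logb fun t => law_self_pos (fun k => P.pX_mem k (q t)) _ (hx t),
      not_le, Real.rpow_lt_rpow_left_iff (by norm_num)] at h
    rw [Finset.sum_add_distrib]
    simp only [Finset.sum_const, Finset.card_univ, Fintype.card_fin, nsmul_eq_mul]
    linarith
  · simp only [prodExp_add, prodExp_const fun k => P.pX_mem k _, mul_add, Finset.sum_add_distrib]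
    rw [← Finset.sum_mul, P.pQ_mem.2, hH]
    simp only [selfEntropy, mul_neg, Finset.sum_neg_distrib]
    linarith

/-- With high probability, the probability of the observed block of signals is at least
`2 ^ (-n (H + ε))`. -/
lemma tendsto_blockProb_not_ge (P : InputDist X Q) {α : Type*}
    (F : (∀ k, X k) → (∀ k, X k) → α) {H ε : ℝ}
    (hH : H = ∑ q, P.pQ q * selfEntropy F fun k => P.pX k q) (hε : 0 < ε) :
    Tendsto (fun n : ℕ => blockProb P n fun q x => ¬ 1 ≤ (2 : ℝ) ^ (n * (H + ε)) *
      ∏ t, law (fun k => P.pX k (q t)) (F fun k => x k t) (F (fun k => x k t) fun k => x k t))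
      atTop (𝓝 0) := by
  refine squeeze_zero (fun n => blockProb_nonneg P n _) (fun n => ?_)
    (tendsto_blockProb_sum_nonneg P (φ := fun q x =>
      (-1) * Real.logb 2 (law (fun k => P.pX k q) (F x) (F x x)) + -(H + ε)) ?_)
  · refine blockProb_mono P n fun q x hx h => ?_
    rw [prod_eq_two_rpow_sum_logb fun t => law_self_pos (fun k => P.pX_mem k (q t)) _ (hx t),
      ← Real.rpow_add (by norm_num), ← Real.rpow_zero 2, not_le,
      Real.rpow_lt_rpow_left_iff (by norm_num)] at h
    rw [Finset.sum_add_distrib, ← Finset.mul_sum]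
    simp only [Finset.sum_const, Finset.card_univ, Fintype.card_fin, nsmul_eq_mul]
    linarith
  · simp only [prodExp_add, prodExp_const_mul, prodExp_const fun k => P.pX_mem k _, mul_add,
      Finset.sum_add_distrib]
    rw [← Finset.sum_mul, P.pQ_mem.2, hH]
    simp only [selfEntropy, neg_mul, one_mul, mul_neg, Finset.sum_neg_distrib]
    linarith

end Block

namespace ThreeDIC

variable {X Y S : Fin 3 → Type*} {L : Fin 3 → Fin 3 → Type*} (ch : ThreeDIC X Y S L)

/-- The `n`-fold memoryless use of a channel, as a channel on blocks. -/
def pow (n : ℕ) : ThreeDIC (fun k => Fin n → X k) (fun k => Fin n → Y k)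
    (fun k => Fin n → S k) (fun l k => Fin n → L l k) where
  g l k x t := ch.g l k (x t)
  h k a b t := ch.h k (a t) (b t)
  f k a s t := ch.f k (a t) (s t)
  h_injective_left k b _ _ h := funext fun t => ch.h_injective_left k (b t) (congrFun h t)
  h_injective_right k a _ _ h := funext fun t => ch.h_injective_right k (a t) (congrFun h t)
  f_injective_left k s _ _ h := funext fun t => ch.f_injective_left k (s t) (congrFun h t)
  f_injective_right k a _ _ h := funext fun t => ch.f_injective_right k (a t) (congrFun h t)

variable [∀ k, Fintype (X k)] {Q : Type*} [Fintype Q] (P : InputDist X Q) {n : ℕ}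

lemma law_pow_link (l k : Fin 3) (q : Fin n → Q) (x : ∀ k, Fin n → X k) :
    law (fun k => (P.pow n).pX k q) (fun z => (ch.pow n).g l k (z l)) ((ch.pow n).g l k (x l)) =
      ∏ t, law (fun k => P.pX k (q t)) (fun z => ch.g l k (z l)) (ch.g l k (x l t)) :=
  law_pi (fun t k => P.pX k (q t)) (fun _ z => ch.g l k (z l)) _

lemma law_pow_interference (k : Fin 3) (q : Fin n → Q) (x : ∀ k, Fin n → X k) :
    law (fun k => (P.pow n).pX k q) ((ch.pow n).interference k) ((ch.pow n).interference k x) =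
      ∏ t, law (fun k => P.pX k (q t)) (ch.interference k) (ch.interference k fun k => x k t) :=
  law_pi (fun t k => P.pX k (q t)) (fun _ => ch.interference k) _

lemma law_pow_output (k : Fin 3) (q : Fin n → Q) (x : ∀ k, Fin n → X k) :
    law (fun k => (P.pow n).pX k q) ((ch.pow n).output k) ((ch.pow n).output k x) =
      ∏ t, law (fun k => P.pX k (q t)) (ch.output k) (ch.output k fun k => x k t) :=
  law_pi (fun t k => P.pX k (q t)) (fun _ => ch.output k) _

lemma law_pow_outputGivenLink (l k : Fin 3) (q : Fin n → Q) (x : ∀ k, Fin n → X k) :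
    law (fun k => (P.pow n).pX k q)
        (fun z => (ch.pow n).output k (Function.update z l (x l))) ((ch.pow n).output k x) =
      ∏ t, law (fun k => P.pX k (q t)) (fun z => ch.output k (Function.update z l (x l t)))
        (ch.output k fun k => x k t) := by
  refine Eq.trans ?_ (law_pi (fun t k => P.pX k (q t))
    (fun t z => ch.output k (Function.update z l (x l t))) _)
  congr 1
  funext z t
  have : (fun k => Function.update z l (x l) k t) =
      Function.update (fun k => z k t) l (x l t) := by
    funext i
    by_cases h : i = l
    · subst h; simp
    · simp [h]
  rw [← this]
  rfl

end ThreeDIC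

/-! ### Achievability -/

section BlockEvents

variable {X : Fin 3 → Type*} [∀ k, Fintype (X k)] {Q : Type*} [Fintype Q] {P : InputDist X Q}

lemma tendsto_blockProb_not_and
    {E F : ∀ n : ℕ, (Fin n → Q) → (∀ k, Fin n → X k) → Prop}
    (hE : Tendsto (fun n => blockProb P n fun q x => ¬ E n q x) atTop (𝓝 0))
    (hF : Tendsto (fun n => blockProb P n fun q x => ¬ F n q x) atTop (𝓝 0)) :
    Tendsto (fun n => blockProb P n fun q x => ¬ (E n q x ∧ F n q x)) atTop (𝓝 0) := by
  refine squeeze_zero (fun n => blockProb_nonneg P n _) (fun n => ?_) (by simpa using hE.add hF)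
  refine (blockProb_mono P n (F := fun q x => ∃ b : Bool, cond b (¬ E n q x) (¬ F n q x))
    fun q x _ h => ?_).trans ((blockProb_exists_le P n _).trans_eq (by simp))
  rcases not_and_or.1 h with h | h
  · exact ⟨true, h⟩
  · exact ⟨false, h⟩

end BlockEvents

namespace ThreeDIC

variable {X Y S : Fin 3 → Type*} {L : Fin 3 → Fin 3 → Type*} [∀ k, Fintype (X k)]
  [∀ k, Fintype (Y k)] [∀ k, Fintype (S k)] [∀ l k, Fintype (L l k)] (ch : ThreeDIC X Y S L)
  {Q : Type*} [Fintype Q] (P : InputDist X Q)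

/-- The thresholds of receiver `k` for blocks of length `n`, at distance `ε` from the entropies. -/
noncomputable def blockThresholds (ε : ℝ) (n : ℕ) (k : Fin 3) : Thresholds where
  fst := 2 ^ (n * (ch.entLink P (k + 1) k + ε))
  snd := 2 ^ (n * (ch.entLink P (k + 2) k + ε))
  sum := 2 ^ (n * (ch.entInterference P k + ε))
  desired := 2 ^ (-(n * (ch.entLink P k k - ε)))
  outGivenSnd := 2 ^ (-(n * (ch.entOutputGivenLink P (k + 2) k - ε)))
  outGivenFst := 2 ^ (-(n * (ch.entOutputGivenLink P (k + 1) k - ε)))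
  out := 2 ^ (-(n * (ch.entOutput P k - ε)))
  fst_nonneg := by positivity
  snd_nonneg := by positivity
  sum_nonneg := by positivity
  desired_nonneg := by positivity
  outGivenSnd_nonneg := by positivity
  outGivenFst_nonneg := by positivity
  out_nonneg := by positivity

/-- Blocks of independent inputs are typical with high probability. -/
lemma tendsto_blockProb_not_typical {ε : ℝ} (hε : 0 < ε) :
    Tendsto (fun n => blockProb P n fun q x => ∃ k, ¬ (ch.pow n).Typical
      (fun k => (P.pow n).pX k q) k (ch.blockThresholds P ε n k) x) atTop (𝓝 0) := by
  suffices h : ∀ k, Tendsto (fun n => blockProb P n fun q x => ¬ (ch.pow n).Typical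
      (fun k => (P.pow n).pX k q) k (ch.blockThresholds P ε n k) x) atTop (𝓝 0) by
    refine squeeze_zero (fun n => blockProb_nonneg P n _)
      (fun n => blockProb_exists_le P n fun k q x => ¬ (ch.pow n).Typical
        (fun k => (P.pow n).pX k q) k (ch.blockThresholds P ε n k) x) ?_
    simpa using tendsto_finsetSum Finset.univ fun k _ => h k
  intro k
  refine tendsto_blockProb_not_and (tendsto_blockProb_not_and ?_ (tendsto_blockProb_not_and ?_
    (tendsto_blockProb_not_and ?_ ?_))) (tendsto_blockProb_not_and ?_
    (tendsto_blockProb_not_and ?_ ?_)) <;>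
    simp only [law_pow_link, law_pow_interference, law_pow_output, law_pow_outputGivenLink,
      blockThresholds]
  · exact tendsto_blockProb_not_le P (fun _ z => ch.g k k (z k)) (ch.entLink_eq P k k) hε
  · have := tendsto_blockProb_not_le P _ (ch.entOutputGivenLink_eq P (k + 2) k) hε
    simpa only [Function.update_eq_self] using this
  · have := tendsto_blockProb_not_le P _ (ch.entOutputGivenLink_eq P (k + 1) k) hε
    simpa only [Function.update_eq_self] using this
  · exact tendsto_blockProb_not_le P (fun _ => ch.output k) (ch.entOutput_eq P k) hε
  · exact tendsto_blockProb_not_ge P (fun _ z => ch.g (k + 1) k (z (k + 1)))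
      (ch.entLink_eq P (k + 1) k) hε
  · exact tendsto_blockProb_not_ge P (fun _ z => ch.g (k + 2) k (z (k + 2)))
      (ch.entLink_eq P (k + 2) k) hε
  · exact tendsto_blockProb_not_ge P (fun _ => ch.interference k) (ch.entInterference_eq P k) hε

end ThreeDIC

section Rates

lemma two_pow_ceil_le {n : ℕ} {R : ℝ} (hR : 0 ≤ R) :
    ((2 ^ ⌈(n : ℝ) * R⌉₊ : ℕ) : ℝ) ≤ 2 * (2 : ℝ) ^ (n * R) := by
  have h : (⌈(n : ℝ) * R⌉₊ : ℝ) ≤ n * R + 1 := (Nat.ceil_lt_add_one (by positivity)).le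
  push_cast
  rw [← Real.rpow_natCast]
  refine (Real.rpow_le_rpow_of_exponent_le (by norm_num) h).trans_eq ?_
  rw [Real.rpow_add (by norm_num), Real.rpow_one, mul_comm]

lemma tendsto_const_mul_two_rpow {C a : ℝ} (ha : a < 0) :
    Tendsto (fun n : ℕ => C * (2 : ℝ) ^ (n * a)) atTop (𝓝 0) := by
  have h : Tendsto (fun n : ℕ => ((2 : ℝ) ^ a) ^ n) atTop (𝓝 0) :=
    tendsto_pow_atTop_nhds_zero_of_lt_one (by positivity)
      (Real.rpow_lt_one_of_one_lt_of_neg (by norm_num) ha)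
  have h' := h.const_mul C
  rw [mul_zero] at h'
  refine h'.congr fun n => ?_
  rw [← Real.rpow_natCast, ← Real.rpow_mul (by norm_num), mul_comm a]

lemma two_rpow_mono {n : ℕ} {a b : ℝ} (h : a ≤ b) : (2 : ℝ) ^ (n * a) ≤ 2 ^ (n * b) :=
  Real.rpow_le_rpow_of_exponent_le (by norm_num) (mul_le_mul_of_nonneg_left h n.cast_nonneg)

lemma min_le_two_rpow {n : ℕ} {M R H ε : ℝ} (hε : 0 ≤ ε) (hM : M ≤ 2 * 2 ^ (n * R)) :
    min M (2 ^ (n * (H + ε))) ≤ 2 * (2 : ℝ) ^ (n * (min R H + ε)) := by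
  rcases min_choice R H with h | h <;> rw [h]
  · have := two_rpow_mono (n := n) (a := R) (b := R + ε) (by linarith)
    exact (min_le_left _ _).trans (by linarith)
  · have : (0 : ℝ) < 2 ^ (n * (H + ε)) := by positivity
    exact (min_le_right _ _).trans (by linarith)

lemma min_four_le_two_rpow {n : ℕ} {M₁ M₂ R₁ R₂ H₁ H₂ H ε : ℝ} (hε : 0 ≤ ε) (h₂ : 0 ≤ M₂)
    (hM₁ : M₁ ≤ 2 * 2 ^ (n * R₁)) (hM₂ : M₂ ≤ 2 * 2 ^ (n * R₂)) :
    min (M₁ * M₂) (min (M₁ * 2 ^ (n * (H₂ + ε)))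
        (min (2 ^ (n * (H₁ + ε)) * M₂) (2 ^ (n * (H + ε))))) ≤
      4 * (2 : ℝ) ^ (n * (min (R₁ + R₂) (min (R₁ + H₂) (min (H₁ + R₂) H)) + ε)) := by
  have hadd (a b : ℝ) : (2 : ℝ) ^ (n * (a + b)) = 2 ^ (n * a) * 2 ^ (n * b) := by
    rw [mul_add, Real.rpow_add (by norm_num)]
  have hpos (a : ℝ) : (0 : ℝ) < 2 ^ (n * a) := by positivity
  have hone : (1 : ℝ) ≤ 2 ^ (n * ε) := Real.one_le_rpow (by norm_num) (by positivity)
  rcases min_choice (R₁ + R₂) (min (R₁ + H₂) (min (H₁ + R₂) H)) with h | h <;> rw [h]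
  · refine (min_le_left _ _).trans ?_
    calc M₁ * M₂ ≤ (2 * 2 ^ (n * R₁)) * (2 * 2 ^ (n * R₂)) :=
          mul_le_mul hM₁ hM₂ h₂ (by positivity)
      _ = 4 * (2 ^ (n * (R₁ + R₂))) * 1 := by rw [hadd]; ring
      _ ≤ 4 * (2 ^ (n * (R₁ + R₂))) * 2 ^ (n * ε) :=
          mul_le_mul_of_nonneg_left hone (by positivity)
      _ = _ := by rw [hadd (R₁ + R₂)]; ring
  refine (min_le_right _ _).trans ?_
  rcases min_choice (R₁ + H₂) (min (H₁ + R₂) H) with h | h <;> rw [h]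
  · refine (min_le_left _ _).trans ?_
    calc M₁ * 2 ^ (n * (H₂ + ε)) ≤ (2 * 2 ^ (n * R₁)) * 2 ^ (n * (H₂ + ε)) :=
          mul_le_mul_of_nonneg_right hM₁ (hpos _).le
      _ = 2 * 2 ^ (n * (R₁ + H₂ + ε)) := by rw [add_assoc, hadd R₁]; ring
      _ ≤ _ := by linarith [hpos (R₁ + H₂ + ε)]
  refine (min_le_right _ _).trans ?_
  rcases min_choice (H₁ + R₂) H with h | h <;> rw [h]
  · refine (min_le_left _ _).trans ?_
    calc 2 ^ (n * (H₁ + ε)) * M₂ ≤ 2 ^ (n * (H₁ + ε)) * (2 * 2 ^ (n * R₂)) :=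
          mul_le_mul_of_nonneg_left hM₂ (hpos _).le
      _ = 2 * 2 ^ (n * (H₁ + R₂ + ε)) := by
          rw [add_right_comm, hadd (H₁ + ε)]; ring
      _ ≤ _ := by linarith [hpos (H₁ + R₂ + ε)]
  · refine (min_le_right _ _).trans ?_
    linarith [hpos (H + ε)]

/-- A product of a message count, an interference count and a probability vanishes when the
exponents add up to a negative number. -/
lemma tendsto_mul_mul_zero {M N : ℕ → ℝ} {R a H ε C : ℝ} (hM0 : ∀ n, 0 ≤ M n)
    (hN0 : ∀ n, 0 ≤ N n) (hM : ∀ n : ℕ, M n ≤ 2 * 2 ^ (n * R))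
    (hN : ∀ n : ℕ, N n ≤ C * 2 ^ (n * (a + ε))) (h : R + a + 2 * ε < H) :
    Tendsto (fun n : ℕ => M n * N n * (2 : ℝ) ^ (-(n * (H - ε)))) atTop (𝓝 0) := by
  refine squeeze_zero (fun n => mul_nonneg (mul_nonneg (hM0 n) (hN0 n)) (by positivity))
    (fun n => ?_) (tendsto_const_mul_two_rpow (C := 2 * C) (a := R + a + 2 * ε - H) (by linarith))
  calc _ ≤ (2 * 2 ^ (n * R)) * (C * 2 ^ (n * (a + ε))) * (2 : ℝ) ^ (-(n * (H - ε))) :=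
        mul_le_mul_of_nonneg_right (mul_le_mul (hM n) (hN n) (hN0 n) (by positivity))
          (by positivity)
    _ = 2 * C * (2 ^ (n * R) * 2 ^ (n * (a + ε)) * (2 : ℝ) ^ (-(n * (H - ε)))) := by ring
    _ = _ := by
        rw [← Real.rpow_add (by norm_num), ← Real.rpow_add (by norm_num)]
        congr 2
        ring

end Rates

namespace ThreeDIC

variable {X Y S : Fin 3 → Type*} {L : Fin 3 → Fin 3 → Type*} [∀ k, Fintype (X k)]
  [∀ k, Fintype (Y k)] [∀ k, Fintype (S k)] [∀ l k, Fintype (L l k)] (ch : ThreeDIC X Y S L)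
  {Q : Type*} [Fintype Q] (P : InputDist X Q)

lemma tendsto_competitionBound {R : Fin 3 → ℝ} (hR : ∀ k, 0 ≤ R k) {k : Fin 3} {ε : ℝ}
    (hε : 0 < ε)
    (h₀ : R k + 2 * ε < ch.entLink P k k)
    (h₁ : R k + min (R (k + 1)) (ch.entLink P (k + 1) k) + 2 * ε
      < ch.entOutputGivenLink P (k + 2) k)
    (h₂ : R k + min (R (k + 2)) (ch.entLink P (k + 2) k) + 2 * ε
      < ch.entOutputGivenLink P (k + 1) k)
    (h₃ : R k + min (R (k + 1) + R (k + 2)) (min (R (k + 1) + ch.entLink P (k + 2) k)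
      (min (ch.entLink P (k + 1) k + R (k + 2)) (ch.entInterference P k))) + 2 * ε
      < ch.entOutput P k) :
    Tendsto (fun n : ℕ => competitionBound (fun k => 2 ^ ⌈(n : ℝ) * R k⌉₊) k
      (ch.blockThresholds P ε n k)) atTop (𝓝 0) := by
  have hM (j : Fin 3) (n : ℕ) := two_pow_ceil_le (n := n) (hR j)
  have hM0 (j : Fin 3) (n : ℕ) : (0 : ℝ) ≤ ((2 ^ ⌈(n : ℝ) * R j⌉₊ : ℕ) : ℝ) := Nat.cast_nonneg _
  have t₀ := tendsto_mul_mul_zero (N := fun _ => 1) (C := 1) (a := 0) (hM0 k)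
    (fun _ => zero_le_one) (hM k) (fun n => by
      rw [one_mul]; exact Real.one_le_rpow (by norm_num) (by positivity))
    (by linarith : R k + 0 + 2 * ε < ch.entLink P k k)
  have t₁ := tendsto_mul_mul_zero (hM0 k)
    (fun n => le_min (hM0 (k + 1) n) (by positivity)) (hM k)
    (fun n => min_le_two_rpow hε.le (hM (k + 1) n)) h₁
  have t₂ := tendsto_mul_mul_zero (hM0 k)
    (fun n => le_min (hM0 (k + 2) n) (by positivity)) (hM k)
    (fun n => min_le_two_rpow hε.le (hM (k + 2) n)) h₂
  have t₃ := tendsto_mul_mul_zero (hM0 k)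
    (fun n => le_min (mul_nonneg (hM0 (k + 1) n) (hM0 (k + 2) n))
      (le_min (mul_nonneg (hM0 (k + 1) n) (by positivity))
        (le_min (mul_nonneg (by positivity) (hM0 (k + 2) n)) (by positivity)))) (hM k)
    (fun n => min_four_le_two_rpow hε.le (hM0 (k + 2) n) (hM (k + 1) n) (hM (k + 2) n)) h₃
  simpa only [competitionBound, blockThresholds, mul_one, add_zero] using
    ((t₀.add t₁).add t₂).add t₃

/-- Rates that satisfy the inequalities of all receivers for an input distribution with any
finite time-sharing alphabet are achievable. -/
theorem achievable_of_mem_receiverRegion {R : Fin 3 → ℝ} (hR : ∀ k, 0 ≤ R k)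
    (h : R ∈ ⋂ k, ch.receiverRegion P k) : ch.Achievable R := by
  classical
  rw [Set.mem_iInter] at h
  have hsmall {a b : ℝ} (hab : a < b) : ∀ᶠ ε in 𝓝[>] (0 : ℝ), a + 2 * ε < b := by
    have : Tendsto (fun ε : ℝ => a + 2 * ε) (𝓝[>] 0) (𝓝 a) := by
      refine (Continuous.tendsto' (by fun_prop) 0 a (by simp)).mono_left nhdsWithin_le_nhds
    exact this.eventually (gt_mem_nhds hab)
  obtain ⟨ε, hεR, hε⟩ := ((eventually_all.2 fun k => (hsmall (h k).1).and
    ((hsmall (h k).2.1).and ((hsmall (h k).2.2.1).and (hsmall (h k).2.2.2)))).and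
      self_mem_nhdsWithin).exists
  choose c dec hc using fun n : ℕ => (ch.pow n).exists_code_le (P.pow n)
    (fun k => 2 ^ ⌈(n : ℝ) * R k⌉₊) (fun _ => by positivity) (ch.blockThresholds P ε n)
  refine ⟨hR, fun n => ⟨c n, dec n⟩, squeeze_zero (fun n => ?_) (fun n => ?_)
    (by simpa using (ch.tendsto_blockProb_not_typical P hε).add (tendsto_finsetSum Finset.univ
      fun k _ => ch.tendsto_competitionBound P hR hε (hεR k).1 (hεR k).2.1 (hεR k).2.2.1
        (hεR k).2.2.2))⟩
  · exact div_nonneg (Nat.cast_nonneg _) (Finset.prod_nonneg fun _ _ => Nat.cast_nonneg _)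
  · exact hc n

end ThreeDIC

/-! ### The size of the time-sharing alphabet -/

section TimeSharing

/-- Carathéodory's theorem for means: a mean of vectors of length `card ι` is also a mean of at
most `card ι + 1` of them. -/
lemma exists_mean_eq_of_card_le {Q ι : Type*} [Fintype Q] [Fintype ι] {w : Q → ℝ}
    (hw : w ∈ stdSimplex ℝ Q) (v : Q → ι → ℝ) :
    ∃ N ≤ Fintype.card ι + 1, ∃ (σ : Fin N → Q), ∃ w' ∈ stdSimplex ℝ (Fin N),
      ∀ j, ∑ i, w' i * v (σ i) j = ∑ q, w q * v q j := by
  have hmem : ∑ q, w q • v q ∈ convexHull ℝ (Set.range v) :=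
    (convex_convexHull ℝ _).sum_mem (fun q _ => hw.1 q) hw.2
      fun q _ => subset_convexHull ℝ _ (Set.mem_range_self q)
  obtain ⟨κ, _, z, w', hz, hind, hpos, hsum, hmean⟩ := eq_pos_convex_span_of_mem_convexHull hmem
  choose σ hσ using fun i => hz (Set.mem_range_self i)
  let e := Fintype.equivFin κ
  refine ⟨Fintype.card κ, ?_, fun i => σ (e.symm i), fun i => w' (e.symm i),
    ⟨fun i => (hpos _).le, ?_⟩, fun j => ?_⟩
  · have h := hind.card_le_finrank_succ
    have h' := (vectorSpan ℝ (Set.range z)).finrank_le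
    rw [Module.finrank_fintype_fun_eq_card] at h'
    omega
  · rw [Equiv.sum_comp e.symm w', hsum]
  · rw [Equiv.sum_comp e.symm fun i => w' i * v (σ i) j]
    have := congrFun hmean j
    simpa [hσ] using this

namespace InputDist

variable {X : Fin 3 → Type*} [∀ k, Fintype (X k)] {Q : Type*} [Fintype Q]

/-- The input distribution with the conditional pmfs of `P` at the symbols `σ i`, used with
probabilities `w i`. -/
def reweight (P : InputDist X Q) {N : ℕ} (σ : Fin N → Q) {w : Fin N → ℝ}
    (hw : w ∈ stdSimplex ℝ (Fin N)) : InputDist X (Fin N) where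
  pQ := w
  pX k i := P.pX k (σ i)
  pQ_mem := hw
  pX_mem k i := P.pX_mem k (σ i)

end InputDist

lemma sum_mul_sub_const {J : Type*} [Fintype J] {w : J → ℝ} (hw : w ∈ stdSimplex ℝ J) (a b : J → ℝ)
    (c d : ℝ) :
    ∑ j, w j * (a j - (c + d * b j)) = ∑ j, w j * a j - (c + d * ∑ j, w j * b j) := by
  simp only [mul_sub, mul_add, Finset.sum_sub_distrib, Finset.sum_add_distrib, ← Finset.sum_mul,
    hw.2, one_mul, Finset.mul_sum]
  congr 2
  exact Finset.sum_congr rfl fun _ _ => by ring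

namespace ThreeDIC

/-- Some linear inequality in the law of the time-sharing symbol holds for `P` and is sufficient
for the condition `C`: a function `v` of the time-sharing symbol has positive mean under `P`, and
every reweighting of `P` under which `v` has positive mean satisfies `C`. -/
def HasLinearWitness {X : Fin 3 → Type*} [∀ k, Fintype (X k)] {Q : Type*} [Fintype Q]
    (P : InputDist X Q) (C : ∀ N : ℕ, InputDist X (Fin N) → Prop) : Prop :=
  ∃ v : Q → ℝ, 0 < ∑ q, P.pQ q * v q ∧ ∀ (N : ℕ) (σ : Fin N → Q) (w : Fin N → ℝ)
    (hw : w ∈ stdSimplex ℝ (Fin N)), 0 < ∑ i, w i * v (σ i) → C N (P.reweight σ hw)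

/-- Comparisons of two means, up to constants, are linear in the law of the time-sharing
symbol. -/
lemma hasLinearWitness_of_lt {X : Fin 3 → Type*} [∀ k, Fintype (X k)] {Q : Type*} [Fintype Q]
    {P : InputDist X Q} {C : ∀ N : ℕ, InputDist X (Fin N) → Prop} (a b : Q → ℝ) (c d : ℝ)
    (h : c + d * ∑ q, P.pQ q * b q < ∑ q, P.pQ q * a q)
    (hC : ∀ (N : ℕ) (σ : Fin N → Q) (w : Fin N → ℝ) (hw : w ∈ stdSimplex ℝ (Fin N)),
      c + d * ∑ i, w i * b (σ i) < ∑ i, w i * a (σ i) → C N (P.reweight σ hw)) :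
    HasLinearWitness P C := by
  refine ⟨fun q => a q - (c + d * b q), ?_, fun N σ w hw hpos => hC N σ w hw ?_⟩
  · rw [sum_mul_sub_const P.pQ_mem]
    linarith
  · rw [sum_mul_sub_const hw (fun i => a (σ i)) fun i => b (σ i)] at hpos
    linarith

variable {X Y S : Fin 3 → Type*} {L : Fin 3 → Fin 3 → Type*} [∀ k, Fintype (X k)]
  [∀ k, Fintype (Y k)] [∀ k, Fintype (S k)] [∀ l k, Fintype (L l k)] (ch : ThreeDIC X Y S L)
  {Q : Type*} [Fintype Q] (P : InputDist X Q)

omit [∀ k, Fintype (Y k)] [∀ k, Fintype (S k)] in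
lemma hasLinearWitness_desired (r : ℝ) (k : Fin 3) (h : r < ch.entLink P k k) :
    HasLinearWitness P fun _ P' => r < ch.entLink P' k k := by
  simp only [entLink_eq] at h ⊢
  exact hasLinearWitness_of_lt _ (fun _ => 0) r 0 (by simpa using h)
    fun N σ w hw h' => by simpa [InputDist.reweight] using h'

omit [∀ k, Fintype (S k)] in
lemma hasLinearWitness_one_interferer (r r' : ℝ) (k l l' : Fin 3)
    (h : r + min r' (ch.entLink P l k) < ch.entOutputGivenLink P l' k) :
    HasLinearWitness P fun _ P' =>
      r + min r' (ch.entLink P' l k) < ch.entOutputGivenLink P' l' k := by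
  simp only [entLink_eq, entOutputGivenLink_eq] at h ⊢
  -- The term that attains the minimum for `P` gives the linear inequality.
  rcases min_choice r' (∑ q, P.pQ q * selfEntropy (fun _ z => ch.g l k (z l)) fun k => P.pX k q)
    with hm | hm <;> rw [hm] at h
  · refine hasLinearWitness_of_lt _ (fun _ => 0) (r + r') 0 (by simpa using h)
      fun N σ w hw h' => lt_of_le_of_lt ?_ h'
    rw [zero_mul, add_zero]
    exact add_le_add le_rfl (min_le_left _ _)
  · refine hasLinearWitness_of_lt _ _ r 1 (by rwa [one_mul])
      fun N σ w hw h' => lt_of_le_of_lt ?_ h'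
    rw [one_mul]
    exact add_le_add le_rfl (min_le_right _ _)

lemma hasLinearWitness_two_interferers (r r₁ r₂ : ℝ) (k l₁ l₂ : Fin 3)
    (h : r + min (r₁ + r₂) (min (r₁ + ch.entLink P l₂ k)
      (min (ch.entLink P l₁ k + r₂) (ch.entInterference P k))) < ch.entOutput P k) :
    HasLinearWitness P fun _ P' => r + min (r₁ + r₂) (min (r₁ + ch.entLink P' l₂ k)
      (min (ch.entLink P' l₁ k + r₂) (ch.entInterference P' k))) < ch.entOutput P' k := by
  rcases min_choice (r₁ + r₂) (min (r₁ + ch.entLink P l₂ k)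
    (min (ch.entLink P l₁ k + r₂) (ch.entInterference P k))) with hm | hm <;> rw [hm] at h
  · rw [entOutput_eq] at h
    refine hasLinearWitness_of_lt _ (fun _ => 0) (r + (r₁ + r₂)) 0 (by simpa using h)
      fun N σ w hw h' => ?_
    rw [entOutput_eq]
    refine lt_of_le_of_lt ?_ h'
    rw [zero_mul, add_zero]
    exact add_le_add le_rfl (min_le_left _ _)
  rcases min_choice (r₁ + ch.entLink P l₂ k)
    (min (ch.entLink P l₁ k + r₂) (ch.entInterference P k)) with hm | hm <;> rw [hm] at h
  · rw [entOutput_eq, entLink_eq, ← add_assoc] at h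
    refine hasLinearWitness_of_lt _ _ (r + r₁) 1 (by rwa [one_mul]) fun N σ w hw h' => ?_
    rw [entOutput_eq]
    refine lt_of_le_of_lt ?_ h'
    rw [one_mul, add_assoc]
    refine add_le_add le_rfl ((min_le_right _ _).trans ((min_le_left _ _).trans_eq ?_))
    rw [entLink_eq]
    rfl
  rcases min_choice (ch.entLink P l₁ k + r₂) (ch.entInterference P k) with hm | hm <;>
    rw [hm] at h
  · rw [entOutput_eq, entLink_eq, add_comm _ r₂, ← add_assoc] at h
    refine hasLinearWitness_of_lt _ _ (r + r₂) 1 (by rwa [one_mul]) fun N σ w hw h' => ?_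
    rw [entOutput_eq]
    refine lt_of_le_of_lt ?_ h'
    rw [one_mul, add_assoc]
    refine add_le_add le_rfl ((min_le_right _ _).trans ((min_le_right _ _).trans
      ((min_le_left _ _).trans_eq ?_)))
    rw [entLink_eq, add_comm]
    rfl
  · rw [entOutput_eq, entInterference_eq] at h
    refine hasLinearWitness_of_lt _ _ r 1 (by rwa [one_mul]) fun N σ w hw h' => ?_
    rw [entOutput_eq]
    refine lt_of_le_of_lt ?_ h'
    rw [one_mul]
    refine add_le_add le_rfl ((min_le_right _ _).trans ((min_le_right _ _).trans
      ((min_le_right _ _).trans_eq ?_)))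
    rw [entInterference_eq]
    rfl

/-- Thirteen time-sharing symbols suffice: there are twelve inequalities, and each of them follows
from one that is linear in the law of the time-sharing symbol. -/
theorem mem_idRegion_of_mem_receiverRegion {R : Fin 3 → ℝ} (hR : ∀ k, 0 ≤ R k)
    (h : R ∈ ⋂ k, ch.receiverRegion P k) : R ∈ ch.idRegion := by
  rw [Set.mem_iInter] at h
  choose v₀ hv₀ hC₀ using fun k => ch.hasLinearWitness_desired P _ k (h k).1
  choose v₁ hv₁ hC₁ using fun k => ch.hasLinearWitness_one_interferer P _ _ k _ _ (h k).2.1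
  choose v₂ hv₂ hC₂ using fun k => ch.hasLinearWitness_one_interferer P _ _ k _ _ (h k).2.2.1
  choose v₃ hv₃ hC₃ using fun k => ch.hasLinearWitness_two_interferers P _ _ _ k _ _ (h k).2.2.2
  obtain ⟨N, hN, σ, w, hw, hmean⟩ := exists_mean_eq_of_card_le P.pQ_mem
    fun q (j : Fin 3 × Fin 4) => ![v₀ j.1 q, v₁ j.1 q, v₂ j.1 q, v₃ j.1 q] j.2
  refine ⟨hR, N, by simpa using hN, P.reweight σ hw, Set.mem_iInter.2 fun k => ⟨?_, ?_, ?_, ?_⟩⟩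
  · exact hC₀ k N σ w hw ((hmean (k, 0)).symm ▸ hv₀ k)
  · exact hC₁ k N σ w hw ((hmean (k, 1)).symm ▸ hv₁ k)
  · exact hC₂ k N σ w hw ((hmean (k, 2)).symm ▸ hv₂ k)
  · exact hC₃ k N σ w hw ((hmean (k, 3)).symm ▸ hv₃ k)

end ThreeDIC

end TimeSharing

/-! ### The inner bound -/

theorem theorem1 {X Y S : Fin 3 → Type*} {L : Fin 3 → Fin 3 → Type*}
    [∀ k, Fintype (X k)] [∀ k, Fintype (Y k)] [∀ k, Fintype (S k)] [∀ l k, Fintype (L l k)]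
    (ch : ThreeDIC X Y S L) :
    -- every rate triple of the region is achievable
    (∀ R ∈ ch.idRegion, ch.Achievable R) ∧
    -- the region is an inner bound to the capacity region
    ch.idRegion ⊆ ch.capacityRegion ∧
    -- the bound 13 on the time-sharing alphabet loses nothing
    (∀ (Q : Type*) [Fintype Q] (P : InputDist X Q) (R : Fin 3 → ℝ),
      (∀ k, 0 ≤ R k) → R ∈ ⋂ k, ch.receiverRegion P k → R ∈ ch.idRegion) :=
  ⟨fun _ ⟨hR, _, _, P, h⟩ => ch.achievable_of_mem_receiverRegion P hR h,
    fun _ ⟨hR, _, _, P, h⟩ => subset_closure (ch.achievable_of_mem_receiverRegion P hR h),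
    fun _ _ P _ hR h => ch.mem_idRegion_of_mem_receiverRegion P hR h⟩
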